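/- Let $M$ be a closed (compact, without boundary, Hausdorff) smooth $n$-manifold. Write $H^1(M;\mathbb R)$ for its first de Rham cohomology, a finite-dimensional real vector space with its usual topology, and $$S(M) = (H^1(M;\mathbb R)\setminus\{0\})/\mathbb R_{>0}$$ with the quotient topology. Near each point a smooth closed $1$-form $\omega$ on $M$ is $df$ for a smooth function $f$, unique up to a constant, and a zero of $\omega$ is a critical point of $f$. The zero is non-degenerate if the Hessian of $f$ there is non-singular, and its Morse index is the index of this Hessian (the maximal dimension of a subspace on which it is negative definite); $\omega$ is Morse if all its zeros are non-degenerate. For a Morse closed $1$-form $\omega$ let $m_i(\omega)$ be the number of its zeros of Morse index $i$. For a class $\xi \in H^1(M;\mathbb R)$ the $i$-th Morse rank is $$\mathrm{mrank}_i(\xi) = \min\{\, m_i(\omega) : \omega \text{ a Morse closed } 1\text{-form with } [\omega]=\xi \,\};$$ it is invariant under $\xi\mapsto r\xi$ for $r>0$. A point of $S(M)$ is rational if it is represented by a nonzero class in the image of $H^1(M;\mathbb Z)\to H^1(M;\mathbb R)$, that is, a class all of whose periods over loops are integers. Then, for each $i\in\{0,1,\dots,n\}$: 1. for every nonzero $\xi\in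 H^1(M;\mathbb R)$ the minimum defining $\mathrm{mrank}_i(\xi)$ is attained and is a (finite) natural number, so that $\mathrm{mrank}_i$ is a well-defined function $S(M)\to\mathbb N$; 2. $\mathrm{mrank}_i: S(M)\to\mathbb N$ is upper semi-continuous: each $x\in S(M)$ has an open neighbourhood $N(x)$ with $\mathrm{mrank}_i(y)\le \mathrm{mrank}_i(x)$ for all $y\in N(x)$; 3. the set $\Sigma_i\subseteq S(M)$ of all points of minimal $i$-th Morse rank is open in $S(M)$; 4. the rational points in $\Sigma_i$ are dense in $\Sigma_i$. -/

import Mathlib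

open Set Filter Topology Manifold Bundle
open scoped ContDiff

noncomputable section

namespace MorseRank

/-- The model space `ℝⁿ`. -/
abbrev Euc (n : ℕ) : Type := EuclideanSpace ℝ (Fin n)

section Forms

variable (n : ℕ) (M : Type*) [TopologicalSpace M] [ChartedSpace (Euc n) M]
  [IsManifold (𝓡 n) ∞ M]

/-- Smooth `1`-forms on the `n`-manifold `M`: smooth sections of the cotangent bundle. -/
def OneForm : Type _ :=
  Cₛ^∞⟮𝓡 n; Euc n →L[ℝ] ℝ, fun x : M ↦ TangentSpace (𝓡 n) x →L[ℝ] Bundle.Trivial M ℝ x⟯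

instance : AddCommGroup (OneForm n M) :=
  inferInstanceAs (AddCommGroup
    Cₛ^∞⟮𝓡 n; Euc n →L[ℝ] ℝ, fun x : M ↦ TangentSpace (𝓡 n) x →L[ℝ] Bundle.Trivial M ℝ x⟯)

instance : Module ℝ (OneForm n M) :=
  inferInstanceAs (Module ℝ
    Cₛ^∞⟮𝓡 n; Euc n →L[ℝ] ℝ, fun x : M ↦ TangentSpace (𝓡 n) x →L[ℝ] Bundle.Trivial M ℝ x⟯)

variable {n M}

/-- The value of a `1`-form at a point, as a continuous linear functional on the tangent space. -/
def OneForm.at (α : OneForm n M) (x : M) : TangentSpace (𝓡 n) x →L[ℝ] ℝ :=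
  ContMDiffSection.toFun α x

/-- The coefficients of `α` in the chart `φ` at `x₀`: the pullback `(φ⁻¹)^* α`, a `1`-form on the
open set `φ.target ⊆ ℝⁿ` (its values outside `φ.target` are irrelevant). -/
def localRep (α : OneForm n M) (x₀ : M) (y : Euc n) : Euc n →L[ℝ] ℝ :=
  (α.at ((extChartAt (𝓡 n) x₀).symm y)).comp
    (mfderiv 𝓘(ℝ, Euc n) (𝓡 n) (extChartAt (𝓡 n) x₀).symm y)

theorem localRep_add (α β : OneForm n M) (x₀ : M) :
    localRep (α + β) x₀ = localRep α x₀ + localRep β x₀ := by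
  funext y
  exact ContinuousLinearMap.add_comp _ _ _

theorem localRep_smul (r : ℝ) (α : OneForm n M) (x₀ : M) :
    localRep (r • α) x₀ = r • localRep α x₀ := by
  funext y
  exact ContinuousLinearMap.smul_comp _ _ _

theorem localRep_contDiffOn (α : OneForm n M) (x₀ : M) :
    ContDiffOn ℝ ∞ (localRep α x₀) (extChartAt (𝓡 n) x₀).target := by
  have h1 : ContMDiffOn (𝓡 n) 𝓘(ℝ, Euc n →L[ℝ] ℝ) ∞
      (fun x ↦ ((trivializationAt (Euc n →L[ℝ] ℝ)
        (fun x : M ↦ TangentSpace (𝓡 n) x →L[ℝ] Bundle.Trivial M ℝ x) x₀) ⟨x, α.at x⟩).2)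
      (chartAt (Euc n) x₀).source := by
    have := (Trivialization.contMDiffOn_iff (n := ∞) (IB := 𝓡 n) (IM := 𝓡 n)
      (e := trivializationAt (Euc n →L[ℝ] ℝ)
        (fun x : M ↦ TangentSpace (𝓡 n) x →L[ℝ] Bundle.Trivial M ℝ x) x₀)
      (f := fun x ↦ ⟨x, α.at x⟩) (s := (chartAt (Euc n) x₀).source) (by
        intro x hx
        rw [Trivialization.mem_source]
        simpa using hx)).1 (ContMDiffSection.contMDiff α).contMDiffOn
    exact this.2
  have h2 := h1.comp (contMDiffOn_extChartAt_symm (I := 𝓡 n) (n := ∞) x₀) (by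
    intro y hy
    simpa using (extChartAt (𝓡 n) x₀).map_target hy)
  rw [contMDiffOn_iff_contDiffOn] at h2
  refine h2.congr fun y hy ↦ ?_
  have hx : (extChartAt (𝓡 n) x₀).symm y ∈ (chartAt (Euc n) x₀).source := by
    simpa using (extChartAt (𝓡 n) x₀).map_target hy
  simp only [Function.comp]
  rw [hom_trivializationAt_apply]
  simp only [ContinuousLinearMap.inCoordinates]
  rw [TangentBundle.symmL_trivializationAt hx]
  have hr : extChartAt (𝓡 n) x₀ ((extChartAt (𝓡 n) x₀).symm y) = y :=
    (extChartAt (𝓡 n) x₀).right_inv hy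
  let F : Euc n → Euc n →L[ℝ] Euc n := fun z ↦
    mfderivWithin 𝓘(ℝ, Euc n) (𝓡 n) (extChartAt (𝓡 n) x₀).symm (range (𝓡 n)) z
  have hF : F y = mfderiv 𝓘(ℝ, Euc n) (𝓡 n) (extChartAt (𝓡 n) x₀).symm y := by
    simp only [F, modelWithCornersSelf_coe, range_id, mfderivWithin_univ]
    rfl
  have hT : (trivializationAt ℝ (Bundle.Trivial M ℝ) x₀).continuousLinearMapAt ℝ
      ((extChartAt (𝓡 n) x₀).symm y) = ContinuousLinearMap.id ℝ ℝ :=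
    Trivial.continuousLinearMapAt_trivialization ℝ M ℝ _
  rw [hT]
  ext v
  change α.at ((extChartAt (𝓡 n) x₀).symm y)
      (mfderiv 𝓘(ℝ, Euc n) (𝓡 n) (extChartAt (𝓡 n) x₀).symm y v) =
    α.at ((extChartAt (𝓡 n) x₀).symm y) (F (extChartAt (𝓡 n) x₀ ((extChartAt (𝓡 n) x₀).symm y)) v)
  rw [hr, hF]
  rfl

/-- `α` is closed, `dα = 0`: in every chart the derivative `(u, v) ↦ (D_u a)(v)` of the coefficients
`a` of `α` is symmetric, that is `∂ᵢ aⱼ = ∂ⱼ aᵢ` throughout the chart. -/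
def IsClosedForm (α : OneForm n M) : Prop :=
  ∀ x₀ : M, ∀ y ∈ (extChartAt (𝓡 n) x₀).target, ∀ u v : Euc n,
    fderiv ℝ (localRep α x₀) y u v = fderiv ℝ (localRep α x₀) y v u

/-- `α` is exact: `α = df` for a smooth function `f : M → ℝ`. -/
def IsExactForm (α : OneForm n M) : Prop :=
  ∃ f : M → ℝ, ContMDiff (𝓡 n) 𝓘(ℝ, ℝ) ∞ f ∧ ∀ x : M, α.at x = mfderiv (𝓡 n) 𝓘(ℝ, ℝ) f x

theorem localRep_differentiableAt (α : OneForm n M) (x₀ : M) {y : Euc n}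
    (hy : y ∈ (extChartAt (𝓡 n) x₀).target) : DifferentiableAt ℝ (localRep α x₀) y :=
  ((localRep_contDiffOn α x₀).contDiffAt
    ((isOpen_extChartAt_target (I := 𝓡 n) x₀).mem_nhds hy)).differentiableAt (by simp)

variable (n M)

/-- The space of closed `1`-forms. -/
def closedForms : Submodule ℝ (OneForm n M) where
  carrier := {α | IsClosedForm α}
  zero_mem' := by
    intro x₀ y _ u v
    have h : localRep (0 : OneForm n M) x₀ = 0 := by
      have := localRep_smul (0 : ℝ) (0 : OneForm n M) x₀
      rwa [zero_smul, zero_smul] at this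
    simp [h]
  add_mem' := by
    intro α β hα hβ x₀ y hy u v
    rw [localRep_add, fderiv_add (localRep_differentiableAt α x₀ hy)
      (localRep_differentiableAt β x₀ hy)]
    simp [hα x₀ y hy u v, hβ x₀ y hy u v]
  smul_mem' := by
    intro r α hα x₀ y hy u v
    rw [localRep_smul, fderiv_const_smul (localRep_differentiableAt α x₀ hy)]
    simp [hα x₀ y hy u v]

/-- The space of exact `1`-forms. -/
def exactForms : Submodule ℝ (OneForm n M) where
  carrier := {α | IsExactForm α}
  zero_mem' := ⟨fun _ ↦ 0, contMDiff_const, fun x ↦ by rw [mfderiv_const]; rfl⟩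
  add_mem' := by
    rintro α β ⟨f, hf, hα⟩ ⟨g, hg, hβ⟩
    refine ⟨f + g, hf.add hg, fun x ↦ ?_⟩
    rw [mfderiv_add (hf.mdifferentiable (by simp) x) (hg.mdifferentiable (by simp) x),
      ← hα x, ← hβ x]
    rfl
  smul_mem' := by
    rintro r α ⟨f, hf, hα⟩
    refine ⟨fun x ↦ r * f x, contMDiff_const.mul hf, fun x ↦ ?_⟩
    have h := const_smul_mfderiv (s := r) (hf.mdifferentiable (by simp) x)
    rw [← hα x] at h
    exact h.symm

/-- The first de Rham cohomology `H¹(M; ℝ)`: closed `1`-forms modulo exact `1`-forms. -/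
def H1 : Type _ :=
  closedForms n M ⧸ (exactForms n M).comap (closedForms n M).subtype

instance : AddCommGroup (H1 n M) :=
  inferInstanceAs (AddCommGroup (closedForms n M ⧸ (exactForms n M).comap (closedForms n M).subtype))

instance : Module ℝ (H1 n M) :=
  inferInstanceAs (Module ℝ (closedForms n M ⧸ (exactForms n M).comap (closedForms n M).subtype))

/-- The usual vector space topology of `H¹(M; ℝ)` (which has finite dimension for compact `M`):
the finest topology for which addition and scalar multiplication are continuous. -/
instance : TopologicalSpace (H1 n M) := moduleTopology ℝ (H1 n M)

/-- The sphere `S(M) = (H¹(M; ℝ) ∖ {0}) / ℝ_{>0}`. -/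
def S : Type _ := Module.Ray ℝ (H1 n M)

/-- The quotient topology on `S(M)`, from the subspace topology of `H¹(M; ℝ) ∖ {0}`. -/
instance : TopologicalSpace (S n M) :=
  TopologicalSpace.coinduced
    (fun ξ : {ξ : H1 n M // ξ ≠ 0} ↦ (rayOfNeZero ℝ ξ.1 ξ.2 : Module.Ray ℝ (H1 n M)))
    inferInstance

variable {n M}

/-- The point `[ξ]` of `S(M)` given by a nonzero class `ξ`. -/
def toS (ξ : H1 n M) (hξ : ξ ≠ 0) : S n M := rayOfNeZero ℝ ξ hξ

/-- The cohomology class of a closed `1`-form. -/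
def cohomologyClass : closedForms n M →ₗ[ℝ] H1 n M :=
  ((exactForms n M).comap (closedForms n M).subtype).mkQ

/-- The Hessian at `x`, in the chart at `x`, of a local primitive `f` of `α`: as `α = df` near `x`,
the coefficients of `α` are the partial derivatives of `f`, and the Hessian of `f` is their
derivative. It is used only at zeros `x` of closed forms `α`. -/
def hessian (α : OneForm n M) (x : M) : LinearMap.BilinForm ℝ (Euc n) :=
  (fderiv ℝ (localRep α x) (extChartAt (𝓡 n) x x)).toBilinForm

/-- The Morse index of `α` at a zero `x`: the index of the Hessian, that is the largest dimension
of a subspace on which it is negative definite. -/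
def morseIndex (α : OneForm n M) (x : M) : ℕ :=
  sigNeg (hessian α x).toQuadraticMap

/-- `α` is Morse: all its zeros are non-degenerate. -/
def IsMorse (α : OneForm n M) : Prop :=
  ∀ x : M, α.at x = 0 → (hessian α x).Nondegenerate

/-- The zeros of `α` of Morse index `i`. -/
def zerosOfIndex (α : OneForm n M) (i : ℕ) : Set M :=
  {x | α.at x = 0 ∧ morseIndex α x = i}

/-- The numbers `m_i(α)` of zeros of index `i`, for `α` a Morse closed `1`-form in the class `ξ`
(for compact `M` these numbers are always finite). -/
def morseNumbers (i : ℕ) (ξ : H1 n M) : Set ℕ :=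
  {k | ∃ α : closedForms n M, cohomologyClass α = ξ ∧ IsMorse (α : OneForm n M) ∧
    (zerosOfIndex (α : OneForm n M) i).encard = k}

/-- The `i`-th Morse rank of a class: the least number `m_i(α)`, for `α` a Morse closed
`1`-form in the class. -/
def mrankClass (i : ℕ) (ξ : H1 n M) : ℕ := sInf (morseNumbers i ξ)

theorem hessian_smul (r : ℝ) (α : OneForm n M) (x : M) :
    hessian (r • α) x = r • hessian α x := by
  unfold hessian
  rw [localRep_smul, fderiv_const_smul (localRep_differentiableAt α x
    (mem_extChartAt_target (I := 𝓡 n) x))]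
  rfl

theorem at_smul_eq_zero_iff {r : ℝ} (hr : 0 < r) (α : OneForm n M) (x : M) :
    (r • α).at x = 0 ↔ α.at x = 0 := by
  change r • α.at x = 0 ↔ _
  simp [hr.ne']

theorem sigNeg_le_smul {r : ℝ} (hr : 0 < r) (B : LinearMap.BilinForm ℝ (Euc n)) :
    sigNeg B.toQuadraticMap ≤ sigNeg (r • B).toQuadraticMap := by
  obtain ⟨V, hV, hpos⟩ := exists_finrank_eq_sigNeg_and_negDef B.toQuadraticMap
  rw [← hV]
  refine le_sigNeg_of_negDef _ fun v hv ↦ ?_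
  have h := mul_pos hr (hpos v hv)
  simpa using h

theorem morseIndex_smul {r : ℝ} (hr : 0 < r) (α : OneForm n M) (x : M) :
    morseIndex (r • α) x = morseIndex α x := by
  unfold morseIndex
  rw [hessian_smul]
  refine le_antisymm ?_ (sigNeg_le_smul hr _)
  have h := sigNeg_le_smul (inv_pos.2 hr) (r • hessian α x)
  rwa [smul_smul, inv_mul_cancel₀ hr.ne', one_smul] at h

theorem morseNumbers_subset_smul {r : ℝ} (hr : 0 < r) (i : ℕ) (ξ : H1 n M) :
    morseNumbers i ξ ⊆ morseNumbers i (r • ξ) := by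
  rintro k ⟨α, hα, hM, hk⟩
  refine ⟨r • α, by rw [map_smul, hα], fun x hx ↦ ?_, ?_⟩
  · rw [Submodule.coe_smul, hessian_smul]
    have h := hM x ((at_smul_eq_zero_iff hr _ x).1 hx)
    refine ⟨fun v hv ↦ h.1 v fun w ↦ ?_, fun v hv ↦ h.2 v fun w ↦ ?_⟩
    · simpa [hr.ne'] using hv w
    · simpa [hr.ne'] using hv w
  · rw [← hk]
    congr 1
    ext x
    simp only [zerosOfIndex, Set.mem_ofPred_eq, Submodule.coe_smul, at_smul_eq_zero_iff hr,
      morseIndex_smul hr]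

theorem morseNumbers_smul {r : ℝ} (hr : 0 < r) (i : ℕ) (ξ : H1 n M) :
    morseNumbers i (r • ξ) = morseNumbers i ξ := by
  refine (morseNumbers_subset_smul hr i ξ).antisymm' ?_
  have := morseNumbers_subset_smul (inv_pos.2 hr) i (r • ξ)
  rwa [smul_smul, inv_mul_cancel₀ hr.ne', one_smul] at this

/-- The `i`-th Morse rank as a function on `S(M)`; it is well defined as the Morse rank of a class
is invariant under positive scaling. -/
def mrank (i : ℕ) : S n M → ℕ :=
  Quotient.lift (fun ξ : RayVector ℝ (H1 n M) ↦ mrankClass i (ξ : H1 n M)) (by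
    intro ξ η h
    rcases (h : SameRay ℝ (ξ : H1 n M) (η : H1 n M)) with h | h | ⟨r, s, hr, hs, h⟩
    · exact absurd h ξ.2
    · exact absurd h η.2
    · simp only [mrankClass]
      rw [← morseNumbers_smul hr, h, morseNumbers_smul hs])

theorem mrank_toS (i : ℕ) (ξ : H1 n M) (hξ : ξ ≠ 0) : mrank i (toS ξ hξ) = mrankClass i ξ := rfl

/-- The period `∫_γ α` of `α` over the loop `γ : [0, 1] → M`. -/
def period (α : OneForm n M) (γ : ℝ → M) : ℝ :=
  ∫ t in (0 : ℝ)..1, α.at (γ t) (mfderiv 𝓘(ℝ, ℝ) (𝓡 n) γ t (1 : ℝ))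

/-- `ξ` is an integral class (it lies in the image of `H¹(M; ℤ) → H¹(M; ℝ)`): the periods of a
representative over all smooth loops, that is smooth `1`-periodic maps `ℝ → M`, are integers. -/
def IsIntegral (ξ : H1 n M) : Prop :=
  ∃ α : closedForms n M, cohomologyClass α = ξ ∧
    ∀ γ : ℝ → M, ContMDiff 𝓘(ℝ, ℝ) (𝓡 n) ∞ γ → Function.Periodic γ 1 →
      ∃ k : ℤ, period (α : OneForm n M) γ = k

/-- The rational points of `S(M)`: the points represented by an integral class. -/
def rationalPoints : Set (S n M) :=
  {x | ∃ (ξ : H1 n M) (hξ : ξ ≠ 0), x = toS ξ hξ ∧ IsIntegral ξ}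

/-- The points of `S(M)` of minimal `i`-th Morse rank. -/
def minimalPoints (i : ℕ) : Set (S n M) :=
  {x | ∀ y : S n M, mrank i x ≤ mrank i y}

end Forms

end MorseRank

end

open MorseRank

noncomputable section

set_option linter.unusedSectionVars false

/-! The heart of the proof is that Morse data persist under small changes of the class. Let α be a
Morse closed form. Non-degenerate zeros are isolated, so by compactness the zero set Z is finite
(`finite_zeros`). Every class has a representative vanishing near Z: subtract the differential of a
function that is a primitive near Z. Choose such representatives for a basis of H¹. A small
combination of them added to α changes nothing near Z and, by compactness, creates no zero
elsewhere. Hence every class near [α] contains a Morse form with the same zeros and indices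
(`eventually_mem_morseNumbers`). Sublevel sets of the rank are therefore open, which gives
semi-continuity and openness of the minimal set.

The minimum is attained because every class contains a Morse form (`exists_isMorse`): Sard's theorem
in a chart gives exact perturbations that remove degenerate zeros locally, and stability of
non-degeneracy on compact sets lets finitely many of them be made in succession.

Finite dimension and density both come from a Čech description. On a suitable finite cover, real
1-cocycles surject onto H¹ (`GoodCover.cocycleClass_surjective`). A real cocycle is a real
combination of integral ones, whose classes have integral periods. Replacing the coefficients by
nearby rationals and clearing denominators yields rational points near any given point, and inside
the minimal set because that set is open. -/

namespace MorseRank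

/-! ### Closed forms glued from differentials of functions -/

section LocalForms

variable {n : ℕ} {M : Type*} [TopologicalSpace M] [ChartedSpace (Euc n) M]
  [IsManifold (𝓡 n) ∞ M]

theorem OneForm.ext {α β : OneForm n M} (h : ∀ x, α.at x = β.at x) : α = β :=
  ContMDiffSection.ext h

@[simp] theorem at_add (α β : OneForm n M) (x : M) : (α + β).at x = α.at x + β.at x := rfl

@[simp] theorem at_smul (r : ℝ) (α : OneForm n M) (x : M) : (r • α).at x = r • α.at x := rfl

@[simp] theorem at_sub (α β : OneForm n M) (x : M) : (α - β).at x = α.at x - β.at x := rfl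

@[simp] theorem at_sum {ι : Type*} (s : Finset ι) (α : ι → OneForm n M) (x : M) :
    (∑ j ∈ s, α j).at x = ∑ j ∈ s, (α j).at x :=
  map_sum (AddMonoidHom.mk' (fun α : OneForm n M ↦ α.at x) fun _ _ ↦ rfl) α s

/-- The differential of a function, as a functional on each tangent space. -/
def diff (f : M → ℝ) (x : M) : TangentSpace (𝓡 n) x →L[ℝ] ℝ := mfderiv (𝓡 n) 𝓘(ℝ, ℝ) f x

theorem diff_congr {f g : M → ℝ} {x : M} (h : f =ᶠ[𝓝 x] g) :
    (diff f x : TangentSpace (𝓡 n) x →L[ℝ] ℝ) = diff g x := h.mfderiv_eq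

theorem contMDiffAt_diff {f : M → ℝ} (hf : ContMDiff (𝓡 n) 𝓘(ℝ, ℝ) ∞ f) (x₀ : M) :
    ContMDiffAt (𝓡 n) ((𝓡 n).prod 𝓘(ℝ, Euc n →L[ℝ] ℝ)) ∞ (fun x ↦
      TotalSpace.mk' (Euc n →L[ℝ] ℝ)
        (E := fun x : M ↦ TangentSpace (𝓡 n) x →L[ℝ] Bundle.Trivial M ℝ x) x (diff f x)) x₀ := by
  rw [contMDiffAt_hom_bundle]
  refine ⟨contMDiffAt_id, ?_⟩
  have h := (hf x₀).mfderiv_const (m := ∞) (by simp)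
  refine h.congr_of_eventuallyEq (Eventually.of_forall fun x ↦ ?_)
  simp only [inTangentCoordinates, ContinuousLinearMap.inCoordinates]
  simp [diff]
  rfl

/-- The closed `1`-form with given values that near each point are those of the differential of a
smooth function. -/
def glue (F : ∀ x : M, TangentSpace (𝓡 n) x →L[ℝ] ℝ)
    (hF : ∀ x : M, ∃ f : M → ℝ, ContMDiff (𝓡 n) 𝓘(ℝ, ℝ) ∞ f ∧ ∀ᶠ y in 𝓝 x, F y = diff f y) :
    OneForm n M :=
  ⟨F, fun x ↦ by
    obtain ⟨f, hf, h⟩ := hF x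
    refine (contMDiffAt_diff hf x).congr_of_eventuallyEq ?_
    filter_upwards [h] with y hy
    rw [← hy]⟩

@[simp] theorem glue_at (F : ∀ x : M, TangentSpace (𝓡 n) x →L[ℝ] ℝ)
    (hF : ∀ x : M, ∃ f : M → ℝ, ContMDiff (𝓡 n) 𝓘(ℝ, ℝ) ∞ f ∧ ∀ᶠ y in 𝓝 x, F y = diff f y) (x : M) :
    (glue F hF).at x = F x := rfl

theorem localRep_congr {α β : OneForm n M} {x₀ : M} {y : Euc n}
    (hy : y ∈ (extChartAt (𝓡 n) x₀).target)
    (h : ∀ᶠ x in 𝓝 ((extChartAt (𝓡 n) x₀).symm y), α.at x = β.at x) :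
    localRep α x₀ =ᶠ[𝓝 y] localRep β x₀ := by
  have hc : ContinuousAt (extChartAt (𝓡 n) x₀).symm y := continuousAt_extChartAt_symm'' hy
  filter_upwards [hc.eventually h] with z hz
  simp only [localRep, hz]

theorem mdifferentiableAt_extChartAt_symm {x₀ : M} {y : Euc n}
    (hy : y ∈ (extChartAt (𝓡 n) x₀).target) :
    MDifferentiableAt 𝓘(ℝ, Euc n) (𝓡 n) (extChartAt (𝓡 n) x₀).symm y :=
  ((contMDiffOn_extChartAt_symm (I := 𝓡 n) (n := ∞) x₀).contMDiffAt
    ((isOpen_extChartAt_target (I := 𝓡 n) x₀).mem_nhds hy)).mdifferentiableAt (by simp)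

/-- If `α` agrees with `df` near a point of a chart, then its coefficients are the derivative of
`f` read in the chart. -/
theorem localRep_eventuallyEq_fderiv {α : OneForm n M} {x₀ : M} {y : Euc n} {f : M → ℝ}
    (hf : ContMDiff (𝓡 n) 𝓘(ℝ, ℝ) ∞ f)
    (hy : y ∈ (extChartAt (𝓡 n) x₀).target)
    (h : ∀ᶠ x in 𝓝 ((extChartAt (𝓡 n) x₀).symm y), α.at x = diff f x) :
    localRep α x₀ =ᶠ[𝓝 y] fderiv ℝ (f ∘ (extChartAt (𝓡 n) x₀).symm) := by
  have hc : ContinuousAt (extChartAt (𝓡 n) x₀).symm y := continuousAt_extChartAt_symm'' hy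
  filter_upwards [hc.eventually h, (isOpen_extChartAt_target (I := 𝓡 n) x₀).mem_nhds hy]
    with z hz hzt
  simp only [localRep, hz, diff]
  rw [← mfderiv_eq_fderiv, mfderiv_comp z (hf.mdifferentiable (by simp) _)
    (mdifferentiableAt_extChartAt_symm hzt)]
  rfl

theorem contDiffAt_comp_extChartAt_symm {x₀ : M} {y : Euc n} {f : M → ℝ}
    (hf : ContMDiff (𝓡 n) 𝓘(ℝ, ℝ) ∞ f) (hy : y ∈ (extChartAt (𝓡 n) x₀).target) :
    ContDiffAt ℝ ∞ (f ∘ (extChartAt (𝓡 n) x₀).symm) y := by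
  rw [← contMDiffAt_iff_contDiffAt]
  exact (hf _).comp y ((contMDiffOn_extChartAt_symm (I := 𝓡 n) (n := ∞) x₀).contMDiffAt
    ((isOpen_extChartAt_target (I := 𝓡 n) x₀).mem_nhds hy))

/-- In a chart the coefficients are the derivative of a smooth function, so closedness is the
symmetry of second derivatives. -/
theorem isClosedForm_of_locally_diff {α : OneForm n M}
    (h : ∀ x : M, ∃ f : M → ℝ, ContMDiff (𝓡 n) 𝓘(ℝ, ℝ) ∞ f ∧ ∀ᶠ y in 𝓝 x, α.at y = diff f y) :
    IsClosedForm α := by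
  intro x₀ y hy u v
  obtain ⟨f, hf, hα⟩ := h ((extChartAt (𝓡 n) x₀).symm y)
  rw [(localRep_eventuallyEq_fderiv hf hy hα).fderiv_eq]
  exact ((contDiffAt_comp_extChartAt_symm hf hy).isSymmSndFDerivAt
    (by
      rw [minSmoothness_of_isRCLikeNormedField]; exact WithTop.coe_le_coe.2 le_top)).eq u v

theorem glue_isClosedForm (F : ∀ x : M, TangentSpace (𝓡 n) x →L[ℝ] ℝ)
    (hF : ∀ x : M, ∃ f : M → ℝ, ContMDiff (𝓡 n) 𝓘(ℝ, ℝ) ∞ f ∧ ∀ᶠ y in 𝓝 x, F y = diff f y) :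
    IsClosedForm (glue F hF) :=
  isClosedForm_of_locally_diff hF

/-- The exact form `df`. -/
def dForm (f : M → ℝ) (hf : ContMDiff (𝓡 n) 𝓘(ℝ, ℝ) ∞ f) : closedForms n M :=
  ⟨glue (diff f) fun _ ↦ ⟨f, hf, Eventually.of_forall fun _ ↦ rfl⟩, glue_isClosedForm _ _⟩

@[simp] theorem dForm_at (f : M → ℝ) (hf : ContMDiff (𝓡 n) 𝓘(ℝ, ℝ) ∞ f) (x : M) :
    (dForm f hf : OneForm n M).at x = diff f x := rfl

theorem cohomologyClass_surjective : Function.Surjective (cohomologyClass (n := n) (M := M)) :=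
  Submodule.mkQ_surjective _

@[simp] theorem cohomologyClass_dForm (f : M → ℝ) (hf : ContMDiff (𝓡 n) 𝓘(ℝ, ℝ) ∞ f) :
    cohomologyClass (dForm f hf) = 0 :=
  (Submodule.Quotient.mk_eq_zero _).2 ⟨f, hf, fun _ ↦ rfl⟩

theorem diff_add {f g : M → ℝ} (hf : ContMDiff (𝓡 n) 𝓘(ℝ, ℝ) ∞ f)
    (hg : ContMDiff (𝓡 n) 𝓘(ℝ, ℝ) ∞ g) (x : M) :
    (diff (fun y ↦ f y + g y) x : TangentSpace (𝓡 n) x →L[ℝ] ℝ) = diff f x + diff g x :=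
  mfderiv_add (hf.mdifferentiable (by simp) x) (hg.mdifferentiable (by simp) x)

theorem diff_const_mul {f : M → ℝ} (hf : ContMDiff (𝓡 n) 𝓘(ℝ, ℝ) ∞ f) (r : ℝ) (x : M) :
    (diff (fun y ↦ r * f y) x : TangentSpace (𝓡 n) x →L[ℝ] ℝ) = r • diff f x :=
  const_smul_mfderiv (s := r) (hf.mdifferentiable (by simp) x)

@[simp] theorem diff_const (r : ℝ) (x : M) :
    (diff (fun _ ↦ r) x : TangentSpace (𝓡 n) x →L[ℝ] ℝ) = 0 := mfderiv_const

theorem diff_sum {ι : Type*} (s : Finset ι) {f : ι → M → ℝ}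
    (hf : ∀ i, ContMDiff (𝓡 n) 𝓘(ℝ, ℝ) ∞ (f i)) (x : M) :
    (diff (fun y ↦ ∑ i ∈ s, f i y) x : TangentSpace (𝓡 n) x →L[ℝ] ℝ) = ∑ i ∈ s, diff (f i) x := by
  classical
  induction s using Finset.induction_on with
  | empty => simp
  | insert a s ha ih =>
    simp only [Finset.sum_insert ha]
    rw [diff_add (hf a) (contMDiff_finsetSum fun i _ ↦ hf i), ih]

end LocalForms


/-! ### Change of charts, degeneracy of zeros, and local primitives -/

section Charts

variable {n : ℕ} {M : Type*} [TopologicalSpace M] [ChartedSpace (Euc n) M]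
  [IsManifold (𝓡 n) ∞ M]

theorem mfderiv_extChartAt_symm_comp {x₀ x : M} (hx : x ∈ (extChartAt (𝓡 n) x₀).source) :
    (mfderiv 𝓘(ℝ, Euc n) (𝓡 n) (extChartAt (𝓡 n) x₀).symm (extChartAt (𝓡 n) x₀ x)).comp
      (mfderiv (𝓡 n) 𝓘(ℝ, Euc n) (extChartAt (𝓡 n) x₀) x) =
    ContinuousLinearMap.id ℝ _ := by
  have := mfderivWithin_extChartAt_symm_comp_mfderiv_extChartAt' (I := 𝓡 n) hx
  simpa [modelWithCornersSelf_coe, mfderivWithin_univ] using this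

/-- A form is recovered from its coefficients in a chart. -/
theorem at_eq_localRep_comp (α : OneForm n M) {x₀ x : M}
    (hx : x ∈ (extChartAt (𝓡 n) x₀).source) :
    α.at x = (localRep α x₀ (extChartAt (𝓡 n) x₀ x)).comp
      (mfderiv (𝓡 n) 𝓘(ℝ, Euc n) (extChartAt (𝓡 n) x₀) x) := by
  have hl : (extChartAt (𝓡 n) x₀).symm (extChartAt (𝓡 n) x₀ x) = x :=
    (extChartAt (𝓡 n) x₀).left_inv hx
  -- All tangent spaces are the model space by definition, so values at equal base points can be
  -- compared without a cast.
  have key : ∀ z (hz : z = x) (w : Euc n), α.at z w = α.at x w := by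
    rintro z rfl w; rfl
  ext v
  have h : (mfderiv 𝓘(ℝ, Euc n) (𝓡 n) (extChartAt (𝓡 n) x₀).symm (extChartAt (𝓡 n) x₀ x))
      ((mfderiv (𝓡 n) 𝓘(ℝ, Euc n) (extChartAt (𝓡 n) x₀) x) v) = v :=
    congrArg (fun L : TangentSpace (𝓡 n) x →L[ℝ] TangentSpace (𝓡 n) x ↦ L v)
      (mfderiv_extChartAt_symm_comp (n := n) hx)
  have h2 := key _ hl ((mfderiv 𝓘(ℝ, Euc n) (𝓡 n) (extChartAt (𝓡 n) x₀).symm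
    (extChartAt (𝓡 n) x₀ x)) ((mfderiv (𝓡 n) 𝓘(ℝ, Euc n) (extChartAt (𝓡 n) x₀) x) v))
  exact ((congrArg (α.at x) h).symm.trans h2.symm)

theorem at_eq_of_localRep_eq {α β : OneForm n M} {x₀ x : M}
    (hx : x ∈ (extChartAt (𝓡 n) x₀).source)
    (h : localRep α x₀ (extChartAt (𝓡 n) x₀ x) = localRep β x₀ (extChartAt (𝓡 n) x₀ x)) :
    α.at x = β.at x := by
  rw [at_eq_localRep_comp α hx, at_eq_localRep_comp β hx, h]

@[simp] theorem localRep_zero (x₀ : M) : localRep (0 : OneForm n M) x₀ = 0 := by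
  have := localRep_smul (0 : ℝ) (0 : OneForm n M) x₀
  rwa [zero_smul, zero_smul] at this

theorem localRep_eq_zero_iff (α : OneForm n M) {x₀ x : M}
    (hx : x ∈ (extChartAt (𝓡 n) x₀).source) :
    localRep α x₀ (extChartAt (𝓡 n) x₀ x) = 0 ↔ α.at x = 0 := by
  constructor
  · intro h
    exact at_eq_of_localRep_eq (β := 0) hx (by rw [h, localRep_zero]; rfl)
  · intro h
    unfold localRep
    rw [(extChartAt (𝓡 n) x₀).left_inv hx, h]
    rfl

/-- If a and b are the coefficients in the two charts and τ is the transition map, then a = (b ∘ τ)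
· Dτ. The product rule gives Db(Dτ u)(Dτ v) plus b(D²τ(u, v)), and the second term vanishes at a
zero. Thus T = Dτ. -/
theorem fderiv_localRep_chart_change {α : OneForm n M} {x₀ x : M}
    (hx : x ∈ (extChartAt (𝓡 n) x₀).source) (h0 : α.at x = 0) :
    ∃ T : Euc n →L[ℝ] Euc n, Function.Bijective T ∧ ∀ u v : Euc n,
      fderiv ℝ (localRep α x) (extChartAt (𝓡 n) x x) u v =
        fderiv ℝ (localRep α x₀) (extChartAt (𝓡 n) x₀ x) (T u) (T v) := by
  set φ := extChartAt (𝓡 n) x₀ with hφ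
  set ψ := extChartAt (𝓡 n) x with hψ
  have hsrc : φ.source = (chartAt (Euc n) x₀).source := extChartAt_source (I := 𝓡 n) x₀
  have hxψ : ψ.symm (ψ x) = x := ψ.left_inv (mem_extChartAt_source x)
  have hyt : ψ x ∈ ψ.target := mem_extChartAt_target x
  have hψc : ContinuousAt ψ.symm (ψ x) := continuousAt_extChartAt_symm'' hyt
  have hnhds : ∀ᶠ y in 𝓝 (ψ x), y ∈ ψ.target ∧ ψ.symm y ∈ φ.source := by
    refine Eventually.and ((isOpen_extChartAt_target (I := 𝓡 n) x).mem_nhds hyt) (hψc.preimage_mem_nhds ?_)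
    rw [hxψ]
    exact (isOpen_extChartAt_source (I := 𝓡 n) x₀).mem_nhds hx
  have hτ : ContDiffAt ℝ ∞ (φ ∘ ψ.symm) (ψ x) := by
    rw [← contMDiffAt_iff_contDiffAt]
    refine ContMDiffAt.comp (ψ x) ?_ ((contMDiffOn_extChartAt_symm (I := 𝓡 n) (n := ∞) x).contMDiffAt
      ((isOpen_extChartAt_target (I := 𝓡 n) x).mem_nhds hyt))
    rw [hxψ]
    exact contMDiffAt_extChartAt' (hsrc ▸ hx)
  have hrep : localRep α x =ᶠ[𝓝 (ψ x)] fun y ↦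
      (localRep α x₀ ((φ ∘ ψ.symm) y)).comp (fderiv ℝ (φ ∘ ψ.symm) y) := by
    filter_upwards [hnhds] with y hy
    unfold localRep
    rw [← localRep, ← mfderiv_eq_fderiv, mfderiv_comp y
      (mdifferentiableAt_extChartAt (hsrc ▸ hy.2)) (mdifferentiableAt_extChartAt_symm hy.1)]
    change (α.at (ψ.symm y)).comp _ = _
    rw [at_eq_localRep_comp α hy.2]
    rfl
  have hb : HasFDerivAt (localRep α x₀) (fderiv ℝ (localRep α x₀) (φ x)) ((φ ∘ ψ.symm) (ψ x)) := by
    rw [Function.comp_apply, hxψ]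
    exact (localRep_differentiableAt α x₀ (φ.map_source hx)).hasFDerivAt
  have hd : HasFDerivAt (fderiv ℝ (φ ∘ ψ.symm)) (fderiv ℝ (fderiv ℝ (φ ∘ ψ.symm)) (ψ x)) (ψ x) :=
    ((hτ.fderiv_right (m := ∞) (by simp)).differentiableAt (by simp)).hasFDerivAt
  have hder := (hb.comp (ψ x) (hτ.differentiableAt (by simp)).hasFDerivAt).clm_comp hd
  have hz : localRep α x₀ ((φ ∘ ψ.symm) (ψ x)) = 0 := by
    rw [Function.comp_apply, hxψ]
    exact (localRep_eq_zero_iff α hx).2 h0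
  refine ⟨fderiv ℝ (φ ∘ ψ.symm) (ψ x), ?_, fun u v ↦ ?_⟩
  · have h1 : fderiv ℝ (φ ∘ ψ.symm) (ψ x) =
        (mfderiv (𝓡 n) 𝓘(ℝ, Euc n) φ (ψ.symm (ψ x))).comp
          (mfderiv 𝓘(ℝ, Euc n) (𝓡 n) ψ.symm (ψ x)) := by
      rw [← mfderiv_eq_fderiv, mfderiv_comp (ψ x)
        (mdifferentiableAt_extChartAt (by rw [hxψ]; exact hsrc ▸ hx))
        (mdifferentiableAt_extChartAt_symm hyt)]
    have h2 : Function.Bijective (mfderiv (𝓡 n) 𝓘(ℝ, Euc n) φ (ψ.symm (ψ x))) := by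
      rw [hxψ]
      exact (isInvertible_mfderiv_extChartAt hx).bijective
    have h3 : Function.Bijective (mfderiv 𝓘(ℝ, Euc n) (𝓡 n) ψ.symm (ψ x)) := by
      have := (isInvertible_mfderivWithin_extChartAt_symm (I := 𝓡 n) hyt).bijective
      rwa [modelWithCornersSelf_coe, range_id, mfderivWithin_univ] at this
    rw [h1]
    exact h2.comp h3
  · rw [hrep.fderiv_eq]
    refine (congrArg (fun L : Euc n →L[ℝ] Euc n →L[ℝ] ℝ ↦ L u v) hder.fderiv).trans ?_
    have hz' : ∀ w, localRep α x₀ ((φ ∘ ψ.symm) (ψ x)) w = 0 := fun w ↦ by rw [hz]; rfl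
    exact (add_eq_right (b := fderiv ℝ (localRep α x₀) (φ x) (fderiv ℝ (φ ∘ ψ.symm) (ψ x) u)
      (fderiv ℝ (φ ∘ ψ.symm) (ψ x) v))).2
      (hz' (fderiv ℝ (fderiv ℝ (φ ∘ ψ.symm)) (ψ x) u v))

/-- The zero `x` of `α` is non-degenerate if and only if the coefficients of `α` in a chart have
injective derivative there. -/
theorem hessian_nondegenerate_iff {α : OneForm n M} (hα : IsClosedForm α) {x₀ x : M}
    (hx : x ∈ (extChartAt (𝓡 n) x₀).source) (h0 : α.at x = 0) :
    (hessian α x).Nondegenerate ↔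
      Function.Injective (fderiv ℝ (localRep α x₀) (extChartAt (𝓡 n) x₀ x)) := by
  obtain ⟨T, hT, h⟩ := fderiv_localRep_chart_change hx h0
  have hH : ∀ u v, hessian α x u v =
      fderiv ℝ (localRep α x₀) (extChartAt (𝓡 n) x₀ x) (T u) (T v) := fun u v ↦ h u v
  have hsymm : ∀ u v, hessian α x u v = hessian α x v u := fun u v ↦
    hα x _ (mem_extChartAt_target x) u v
  constructor
  · intro hn
    rw [injective_iff_map_eq_zero]
    intro u hu
    obtain ⟨u, rfl⟩ := hT.2 u
    rw [hn.1 u fun v ↦ by rw [hH, hu]; rfl, map_zero]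
  · intro hi
    have hl : ∀ u, (∀ v, hessian α x u v = 0) → u = 0 := fun u hu ↦ by
      refine hT.1 ((hi ?_).trans (map_zero T).symm)
      rw [map_zero]
      ext v
      obtain ⟨v, rfl⟩ := hT.2 v
      rw [← hH, hu]
      rfl
    exact ⟨hl, fun v hv ↦ hl v fun u ↦ by rw [hsymm, hv]⟩

/-- Multiply by a bump function supported in the chart domain and equal to 1 on `U`. That `U` is
chosen before `g` allows one neighbourhood to serve all closed forms at once. -/
theorem exists_contMDiff_eq_comp_extChartAt [T2Space M] (x₀ : M) {V : Set (Euc n)} (hV : IsOpen V)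
    (hx₀ : extChartAt (𝓡 n) x₀ x₀ ∈ V) :
    ∃ U : Set M, IsOpen U ∧ x₀ ∈ U ∧ U ⊆ (extChartAt (𝓡 n) x₀).source ∧
      MapsTo (extChartAt (𝓡 n) x₀) U V ∧
      ∀ g : Euc n → ℝ, ContDiffOn ℝ ∞ g V → ∃ f : M → ℝ, ContMDiff (𝓡 n) 𝓘(ℝ, ℝ) ∞ f ∧
        ∀ x ∈ U, f x = g (extChartAt (𝓡 n) x₀ x) := by
  have hW : (extChartAt (𝓡 n) x₀).source ∩ extChartAt (𝓡 n) x₀ ⁻¹' V ∈ 𝓝 x₀ :=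
    inter_mem (extChartAt_source_mem_nhds x₀)
      ((continuousAt_extChartAt x₀).preimage_mem_nhds (hV.mem_nhds hx₀))
  obtain ⟨χ, -, hχ⟩ := (SmoothBumpFunction.nhds_basis_tsupport (I := 𝓡 n) x₀).mem_iff.1 hW
  have h1 : χ =ᶠ[𝓝 x₀] 1 := χ.eventuallyEq_one
  obtain ⟨U, hU, hUo, hxU⟩ := eventually_nhds_iff.1 h1
  have hUs : U ⊆ tsupport χ := fun x hx ↦ subset_tsupport _ (by simp [hU x hx])
  refine ⟨U, hUo, hxU, fun x hx ↦ (hχ (hUs hx)).1, fun x hx ↦ (hχ (hUs hx)).2, fun g hg ↦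
    ⟨fun x ↦ χ x * g (extChartAt (𝓡 n) x₀ x), contMDiff_of_tsupport fun x hx ↦ ?_, fun x hx ↦ ?_⟩⟩
  · have hx' := hχ (tsupport_mul_subset_left hx)
    refine χ.contMDiff.contMDiffAt.mul ?_
    have := (hg.contDiffAt (hV.mem_nhds hx'.2)).contMDiffAt
    exact this.comp x (contMDiffAt_extChartAt' (by simpa using hx'.1))
  · simp [hU x hx]

theorem localRep_eventuallyEq_of_comp_extChartAt {α : OneForm n M} {x₀ x : M} {U : Set M}
    {f : M → ℝ} {g : Euc n → ℝ} (hU : IsOpen U) (hxU : x ∈ U)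
    (hUs : U ⊆ (extChartAt (𝓡 n) x₀).source) (hf : ContMDiff (𝓡 n) 𝓘(ℝ, ℝ) ∞ f)
    (hα : ∀ x ∈ U, α.at x = diff f x) (hfg : ∀ x ∈ U, f x = g (extChartAt (𝓡 n) x₀ x)) :
    localRep α x₀ =ᶠ[𝓝 (extChartAt (𝓡 n) x₀ x)] fderiv ℝ g := by
  have hy : extChartAt (𝓡 n) x₀ x ∈ (extChartAt (𝓡 n) x₀).target :=
    (extChartAt (𝓡 n) x₀).map_source (hUs hxU)
  have hl : (extChartAt (𝓡 n) x₀).symm (extChartAt (𝓡 n) x₀ x) = x :=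
    (extChartAt (𝓡 n) x₀).left_inv (hUs hxU)
  refine (localRep_eventuallyEq_fderiv hf hy ?_).trans ?_
  · rw [hl]
    exact eventually_of_mem (hU.mem_nhds hxU) hα
  · have hc : ContinuousAt (extChartAt (𝓡 n) x₀).symm (extChartAt (𝓡 n) x₀ x) :=
      continuousAt_extChartAt_symm'' hy
    have hUe : U ∈ 𝓝 ((extChartAt (𝓡 n) x₀).symm (extChartAt (𝓡 n) x₀ x)) := by
      rw [hl]; exact hU.mem_nhds hxU
    refine EventuallyEq.fderiv ?_
    filter_upwards [hc.preimage_mem_nhds hUe,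
      (isOpen_extChartAt_target (I := 𝓡 n) x₀).mem_nhds hy] with z hz hzt
    rw [Function.comp_apply, hfg _ hz, (extChartAt (𝓡 n) x₀).right_inv hzt]

/-- Each point has a neighbourhood on which all closed forms are exact. -/
theorem exists_nhds_primitive [T2Space M] (x₀ : M) :
    ∃ U : Set M, IsOpen U ∧ x₀ ∈ U ∧ ∀ α : OneForm n M, IsClosedForm α →
      ∃ f : M → ℝ, ContMDiff (𝓡 n) 𝓘(ℝ, ℝ) ∞ f ∧ ∀ x ∈ U, α.at x = diff f x := by
  -- The chart target is shrunk to a ball because the Poincaré lemma is applied on a convex set.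
  obtain ⟨r, hr, hb⟩ := Metric.isOpen_iff.1 (isOpen_extChartAt_target (I := 𝓡 n) x₀) _
    (mem_extChartAt_target (I := 𝓡 n) x₀)
  obtain ⟨U, hU, hxU, hUs, hm, h⟩ := exists_contMDiff_eq_comp_extChartAt (n := n) x₀
    (Metric.isOpen_ball (x := extChartAt (𝓡 n) x₀ x₀) (ε := r)) (Metric.mem_ball_self hr)
  refine ⟨U, hU, hxU, fun α hα ↦ ?_⟩
  have hsm := (localRep_contDiffOn α x₀).mono hb
  obtain ⟨g, hg⟩ := (convex_ball (extChartAt (𝓡 n) x₀ x₀) r).exists_forall_hasFDerivAt_of_fderiv_symmetric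
    Metric.isOpen_ball (hsm.differentiableOn (by simp)) fun a ha u v ↦ hα x₀ a (hb ha) u v
  have hgs : ContDiffOn ℝ ∞ g (Metric.ball (extChartAt (𝓡 n) x₀ x₀) r) := by
    rw [contDiffOn_infty_iff_fderiv_of_isOpen Metric.isOpen_ball]
    exact ⟨fun a ha ↦ (hg a ha).differentiableAt.differentiableWithinAt,
      hsm.congr fun a ha ↦ (hg a ha).fderiv⟩
  obtain ⟨f, hf, hfg⟩ := h g hgs
  refine ⟨f, hf, fun x hx ↦ ?_⟩
  refine at_eq_of_localRep_eq (β := dForm f hf) (hUs hx) ?_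
  rw [(localRep_eventuallyEq_of_comp_extChartAt hU hx hUs hf
    (fun z _ ↦ dForm_at f hf z) hfg).eq_of_nhds,
    (hg _ (hm hx)).fderiv]

end Charts


/-! ### Stability in finite-parameter families of closed forms -/

section Families

variable {n : ℕ} {M : Type*} [TopologicalSpace M] [ChartedSpace (Euc n) M]
  [IsManifold (𝓡 n) ∞ M] {ι : Type*} [Fintype ι]

/-- `x` is not a degenerate zero of `α`. -/
def NondegenerateAt (α : OneForm n M) (x : M) : Prop :=
  α.at x = 0 → (hessian α x).Nondegenerate

/-- The affine family `α + ∑ tⱼ θⱼ` of closed forms. -/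
def family (α : closedForms n M) (θ : ι → closedForms n M) (t : ι → ℝ) : closedForms n M :=
  α + ∑ j, t j • θ j

theorem family_zero (α : closedForms n M) (θ : ι → closedForms n M) : family α θ 0 = α := by
  simp [family]

theorem family_at (α : closedForms n M) (θ : ι → closedForms n M) (t : ι → ℝ) (x : M) :
    (family α θ t : OneForm n M).at x =
      (α : OneForm n M).at x + ∑ j, t j • (θ j : OneForm n M).at x := by
  simp [family]

theorem cohomologyClass_family (α : closedForms n M) (θ : ι → closedForms n M) (t : ι → ℝ) :
    cohomologyClass (family α θ t) = cohomologyClass α + ∑ j, t j • cohomologyClass (θ j) := by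
  simp [family]

theorem localRep_family (α : closedForms n M) (θ : ι → closedForms n M) (t : ι → ℝ) (x₀ : M) :
    localRep (family α θ t : OneForm n M) x₀ =
      fun y ↦ localRep (α : OneForm n M) x₀ y + ∑ j, t j • localRep (θ j : OneForm n M) x₀ y := by
  have hs : localRep (∑ j, t j • (θ j : OneForm n M)) x₀ =
      ∑ j, t j • localRep (θ j : OneForm n M) x₀ := by
    simp_rw [← localRep_smul]
    exact map_sum (AddMonoidHom.mk' (fun β : OneForm n M ↦ localRep β x₀)
      fun β γ ↦ localRep_add β γ x₀) _ _
  funext y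
  simp only [family, Submodule.coe_add, Submodule.coe_sum, Submodule.coe_smul, localRep_add, hs]
  simp

theorem continuousAt_add_sum_smul {X F : Type*} [TopologicalSpace X] [NormedAddCommGroup F]
    [NormedSpace ℝ F] {c : X → F} {d : ι → X → F} (t : ι → ℝ) {x : X} (hc : ContinuousAt c x)
    (hd : ∀ j, ContinuousAt (d j) x) :
    ContinuousAt (fun p : (ι → ℝ) × X ↦ c p.2 + ∑ j, p.1 j • d j p.2) (t, x) := by
  have h2 {e : X → F} (he : ContinuousAt e x) :
      ContinuousAt (fun p : (ι → ℝ) × X ↦ e p.2) (t, x) :=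
    ContinuousAt.comp (f := Prod.snd) (g := e) he continuousAt_snd
  have h1 (j : ι) : ContinuousAt (fun p : (ι → ℝ) × X ↦ p.1 j) (t, x) :=
    ((continuous_apply j).comp continuous_fst).continuousAt
  exact (h2 hc).add (tendsto_finsetSum _ fun j _ ↦ Tendsto.smul (h1 j) (h2 (hd j)))

/-- The derivative is jointly continuous in the parameter and the point, and injectivity is an open
condition on linear maps out of a finite-dimensional space. -/
theorem eventually_injective_fderiv_add_sum_smul {E F : Type*} [NormedAddCommGroup E]
    [NormedSpace ℝ E] [FiniteDimensional ℝ E] [NormedAddCommGroup F] [NormedSpace ℝ F]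
    {c : E → F} {d : ι → E → F} {t : ι → ℝ} {y : E} (hc : ContDiffAt ℝ ∞ c y)
    (hd : ∀ j, ContDiffAt ℝ ∞ (d j) y)
    (h : Function.Injective (fderiv ℝ (fun z ↦ c z + ∑ j, t j • d j z) y)) :
    ∀ᶠ p : (ι → ℝ) × E in 𝓝 (t, y),
      Function.Injective (fderiv ℝ (fun z ↦ c z + ∑ j, p.1 j • d j z) p.2) := by
  have hdiff {e : E → F} (he : ContDiffAt ℝ ∞ e y) : ∀ᶠ z in 𝓝 y, DifferentiableAt ℝ e z :=
    ((he.of_le (m := 1) (by exact_mod_cast le_top)).eventually (by simp)).mono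
      fun z hz ↦ hz.differentiableAt (by simp)
  have hcont {e : E → F} (he : ContDiffAt ℝ ∞ e y) : ContinuousAt (fderiv ℝ e) y :=
    (he.fderiv_right (m := ∞) (by simp)).continuousAt
  have heq : ∀ᶠ p : (ι → ℝ) × E in 𝓝 (t, y), fderiv ℝ (fun z ↦ c z + ∑ j, p.1 j • d j z) p.2 =
      fderiv ℝ c p.2 + ∑ j, p.1 j • fderiv ℝ (d j) p.2 := by
    filter_upwards [continuousAt_snd.eventually (hdiff hc),
      continuousAt_snd.eventually (eventually_all.2 fun j ↦ hdiff (hd j))] with p hp hp'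
    exact (hp.hasFDerivAt.add (HasFDerivAt.fun_sum fun j _ ↦
      (hp' j).hasFDerivAt.const_smul (p.1 j))).fderiv
  have hA := continuousAt_add_sum_smul t (hcont hc) fun j ↦ hcont (hd j)
  have h' := hA.eventually (ContinuousLinearMap.isOpen_injective.mem_nhds
    (by have := heq.self_of_nhds; simp only at this; rw [this] at h; exact h))
  filter_upwards [heq, h'] with p hp hp'
  rw [hp]
  exact hp'

theorem eventually_family_ne_zero (α : closedForms n M) (θ : ι → closedForms n M) {t : ι → ℝ}
    {x₀ : M} (h : (family α θ t : OneForm n M).at x₀ ≠ 0) :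
    ∀ᶠ p : (ι → ℝ) × M in 𝓝 (t, x₀), (family α θ p.1 : OneForm n M).at p.2 ≠ 0 := by
  have hs : ∀ᶠ p : (ι → ℝ) × M in 𝓝 (t, x₀), p.2 ∈ (extChartAt (𝓡 n) x₀).source :=
    continuousAt_snd.eventually (extChartAt_source_mem_nhds (I := 𝓡 n) x₀)
  have hc (β : OneForm n M) : ContinuousAt (localRep β x₀) (extChartAt (𝓡 n) x₀ x₀) :=
    (localRep_differentiableAt β x₀ (mem_extChartAt_target x₀)).continuousAt
  have hne : (fun p : (ι → ℝ) × Euc n ↦ localRep (α : OneForm n M) x₀ p.2 +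
      ∑ j, p.1 j • localRep (θ j : OneForm n M) x₀ p.2) (t, extChartAt (𝓡 n) x₀ x₀) ≠ 0 :=
    fun h0 ↦ h ((localRep_eq_zero_iff _ (mem_extChartAt_source x₀)).1
      (by rw [localRep_family]; exact h0))
  have hφ : ContinuousAt (fun p : (ι → ℝ) × M ↦ (p.1, extChartAt (𝓡 n) x₀ p.2)) (t, x₀) :=
    continuousAt_fst.prodMk (ContinuousAt.comp (f := Prod.snd) (g := extChartAt (𝓡 n) x₀)
      (continuousAt_extChartAt x₀) continuousAt_snd)
  have h' := hφ.eventually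
    ((continuousAt_add_sum_smul t (hc α) fun j ↦ hc (θ j)).eventually_ne hne)
  filter_upwards [hs, h'] with p hp hp' h0
  refine hp' ?_
  have := (localRep_eq_zero_iff _ hp).2 h0
  rwa [localRep_family] at this

theorem eventually_family_nondegenerateAt (α : closedForms n M) (θ : ι → closedForms n M)
    {t : ι → ℝ} {x₀ : M} (h : NondegenerateAt (family α θ t : OneForm n M) x₀) :
    ∀ᶠ p : (ι → ℝ) × M in 𝓝 (t, x₀), NondegenerateAt (family α θ p.1 : OneForm n M) p.2 := by
  by_cases h0 : (family α θ t : OneForm n M).at x₀ = 0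
  · have hs : ∀ᶠ p : (ι → ℝ) × M in 𝓝 (t, x₀), p.2 ∈ (extChartAt (𝓡 n) x₀).source :=
      continuousAt_snd.eventually (extChartAt_source_mem_nhds (I := 𝓡 n) x₀)
    have hi := (hessian_nondegenerate_iff (family α θ t).2 (mem_extChartAt_source x₀) h0).1 (h h0)
    have hsm (β : OneForm n M) : ContDiffAt ℝ ∞ (localRep β x₀) (extChartAt (𝓡 n) x₀ x₀) :=
      (localRep_contDiffOn β x₀).contDiffAt
        ((isOpen_extChartAt_target (I := 𝓡 n) x₀).mem_nhds (mem_extChartAt_target x₀))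
    rw [localRep_family] at hi
    have hφ : ContinuousAt (fun p : (ι → ℝ) × M ↦ (p.1, extChartAt (𝓡 n) x₀ p.2)) (t, x₀) :=
      continuousAt_fst.prodMk (ContinuousAt.comp (f := Prod.snd) (g := extChartAt (𝓡 n) x₀)
        (continuousAt_extChartAt x₀) continuousAt_snd)
    have h' := hφ.eventually (eventually_injective_fderiv_add_sum_smul (hsm _)
      (fun j ↦ hsm (θ j)) hi)
    filter_upwards [hs, h'] with p hp hp' hz
    refine (hessian_nondegenerate_iff (family α θ p.1).2 hp hz).2 ?_
    rw [localRep_family]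
    exact hp'
  · exact (eventually_family_ne_zero α θ h0).mono fun p hp hz ↦ absurd hz hp

theorem eventually_forall_family_ne_zero {K : Set M} (hK : IsCompact K) (α : closedForms n M)
    (θ : ι → closedForms n M) (h : ∀ x ∈ K, (α : OneForm n M).at x ≠ 0) :
    ∀ᶠ t in 𝓝 (0 : ι → ℝ), ∀ x ∈ K, (family α θ t : OneForm n M).at x ≠ 0 :=
  hK.eventually_forall_of_forall_eventually fun x hx ↦
    eventually_family_ne_zero α θ (by rw [family_zero]; exact h x hx)

theorem eventually_forall_family_nondegenerateAt {K : Set M} (hK : IsCompact K)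
    (α : closedForms n M) (θ : ι → closedForms n M)
    (h : ∀ x ∈ K, NondegenerateAt (α : OneForm n M) x) :
    ∀ᶠ t in 𝓝 (0 : ι → ℝ), ∀ x ∈ K, NondegenerateAt (family α θ t : OneForm n M) x :=
  hK.eventually_forall_of_forall_eventually fun x hx ↦
    eventually_family_nondegenerateAt α θ (by rw [family_zero]; exact h x hx)

end Families

/-! ### Existence of Morse forms in every class and finiteness of their zeros -/

section Existence

variable {n : ℕ} {M : Type*} [TopologicalSpace M] [ChartedSpace (Euc n) M]
  [IsManifold (𝓡 n) ∞ M]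

/-- The local form of Sard's theorem: near each point a generic perturbation by differentials of
coordinate functions makes all zeros of a closed form non-degenerate. -/
theorem exists_nhds_ae_nondegenerateAt [T2Space M] (x₀ : M) :
    ∃ U : Set M, IsOpen U ∧ x₀ ∈ U ∧ ∃ θ : Fin n → closedForms n M,
      (∀ j, cohomologyClass (θ j) = 0) ∧ ∀ α : closedForms n M, ∀ᵐ a : Euc n,
        ∀ x ∈ U, NondegenerateAt (family α θ a : OneForm n M) x := by
  obtain ⟨U, hU, hxU, hUs, -, h⟩ := exists_contMDiff_eq_comp_extChartAt (n := n) x₀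
    (isOpen_extChartAt_target (I := 𝓡 n) x₀) (mem_extChartAt_target (I := 𝓡 n) x₀)
  have hp (j : Fin n) : ContDiffOn ℝ ∞ (fun y : Euc n ↦ y j) (extChartAt (𝓡 n) x₀).target :=
    (EuclideanSpace.proj (𝕜 := ℝ) j).contDiff.contDiffOn
  choose f hf hfg using fun j ↦ h _ (hp j)
  refine ⟨U, hU, hxU, fun j ↦ dForm (f j) (hf j), fun j ↦ cohomologyClass_dForm _ _, fun α ↦ ?_⟩
  set φ := extChartAt (𝓡 n) x₀
  set b := localRep (α : OneForm n M) x₀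
  -- Sard's argument: `N` holds the critical points of `b`, and `D` identifies the dual of ℝⁿ with
  -- ℝⁿ. At critical points the determinant vanishes, so the image of `N` under -D ∘ b is null; the
  -- parameters outside this image are the good ones.
  let N : Set (Euc n) := {y | y ∈ φ.target ∧ ¬ Function.Injective (fderiv ℝ b y)}
  let D : (Euc n →L[ℝ] ℝ) →L[ℝ] Euc n := LinearMap.toContinuousLinearMap
    { toFun := fun L ↦ WithLp.toLp 2 fun j ↦ L (EuclideanSpace.single j 1)
      map_add' := fun _ _ ↦ rfl
      map_smul' := fun _ _ ↦ rfl }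
  have hDj (L : Euc n →L[ℝ] ℝ) (j : Fin n) : D L j = L (EuclideanSpace.single j 1) := rfl
  have hD : Function.Injective D := fun L L' h ↦ by
    refine ContinuousLinearMap.coe_injective
      ((EuclideanSpace.basisFun (Fin n) ℝ).toBasis.ext fun j ↦ ?_)
    simpa [hDj] using congrArg (fun v : Euc n ↦ v j) h
  have hnull : MeasureTheory.volume ((fun y ↦ -D (b y)) '' N) = 0 := by
    refine MeasureTheory.addHaar_image_eq_zero_of_det_fderivWithin_eq_zero _
      (f' := fun y ↦ -(D.comp (fderiv ℝ b y))) (fun y hy ↦ ?_) fun y hy ↦ ?_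
    · exact ((D.hasFDerivAt.comp y
        (localRep_differentiableAt _ x₀ hy.1).hasFDerivAt).neg).hasFDerivWithinAt
    · by_contra hdet
      refine hy.2 fun u v huv ↦ ?_
      have hu : IsUnit ((-(D.comp (fderiv ℝ b y)) : Euc n →L[ℝ] Euc n) : Euc n →ₗ[ℝ] Euc n) :=
        (LinearMap.isUnit_iff_isUnit_det _).2 (isUnit_iff_ne_zero.2 hdet)
      refine ((Module.End.isUnit_iff _).1 hu).1 ?_
      simp [huv]
  filter_upwards [MeasureTheory.measure_eq_zero_iff_ae_notMem.1 hnull] with a ha x hx hz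
  have hy : φ x ∈ φ.target := φ.map_source (hUs hx)
  have hloc (j : Fin n) : localRep (dForm (f j) (hf j) : OneForm n M) x₀ =ᶠ[𝓝 (φ x)]
      fun _ ↦ EuclideanSpace.proj j := by
    refine (localRep_eventuallyEq_of_comp_extChartAt hU hx hUs (hf j)
      (fun z _ ↦ dForm_at _ _ z) (g := fun y ↦ y j) (hfg j)).trans (Eventually.of_forall fun y ↦ ?_)
    exact (EuclideanSpace.proj (𝕜 := ℝ) j).fderiv
  rw [hessian_nondegenerate_iff (family α _ a).2 (hUs hx) hz]
  have hrep : localRep (family α (fun j ↦ dForm (f j) (hf j)) a : OneForm n M) x₀ =ᶠ[𝓝 (φ x)]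
      fun y ↦ b y + ∑ j, a j • (EuclideanSpace.proj j : Euc n →L[ℝ] ℝ) := by
    rw [localRep_family]
    filter_upwards [eventually_all.2 hloc] with y hy
    simp only [hy, b]
  have hz' := (localRep_eq_zero_iff _ (hUs hx)).2 hz
  rw [hrep.eq_of_nhds] at hz'
  rw [hrep.fderiv_eq, fderiv_add_const]
  by_contra hinj
  -- At a zero of the perturbed form `b` equals minus the constant covector with coordinates `a`, so
  -- a degenerate zero would make `a` a critical value of -D ∘ b.
  refine ha ⟨φ x, ⟨hy, hinj⟩, ?_⟩
  have hDa : D (∑ j, a j • (EuclideanSpace.proj j : Euc n →L[ℝ] ℝ)) = a := by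
    ext j
    simp [hDj]
  have := congrArg D hz'
  rw [map_add, hDa, map_zero] at this
  exact neg_eq_of_add_eq_zero_right this

/-- Compact induction with an accumulator: `K` is the compact set already free of degenerate zeros.
Each new piece is treated by an exact perturbation small enough to preserve non-degeneracy on `K`.
-/
theorem exists_isMorse [T2Space M] [CompactSpace M] (α : closedForms n M) :
    ∃ β : closedForms n M, cohomologyClass β = cohomologyClass α ∧
      IsMorse (β : OneForm n M) := by
  suffices h : ∀ α : closedForms n M, ∀ K : Set M, IsCompact K →
      (∀ x ∈ K, NondegenerateAt (α : OneForm n M) x) → ∃ β : closedForms n M,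
        cohomologyClass β = cohomologyClass α ∧ ∃ K' : Set M, IsCompact K' ∧ univ ∪ K ⊆ K' ∧
          ∀ x ∈ K', NondegenerateAt (β : OneForm n M) x by
    obtain ⟨β, hβ, K', -, hK', h⟩ := h α ∅ isCompact_empty (by simp)
    exact ⟨β, hβ, fun x ↦ h x (hK' (by simp))⟩
  refine isCompact_univ.induction_on (p := fun s ↦ ∀ α : closedForms n M, ∀ K : Set M,
    IsCompact K → (∀ x ∈ K, NondegenerateAt (α : OneForm n M) x) → ∃ β : closedForms n M,
        cohomologyClass β = cohomologyClass α ∧ ∃ K' : Set M, IsCompact K' ∧ s ∪ K ⊆ K' ∧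
          ∀ x ∈ K', NondegenerateAt (β : OneForm n M) x) ?_ ?_ ?_ ?_
  · exact fun α K hK h ↦ ⟨α, rfl, K, hK, by simp, h⟩
  · intro s t hst ht α K hK h
    obtain ⟨β, hβ, K', hK', hsub, h'⟩ := ht α K hK h
    exact ⟨β, hβ, K', hK', (union_subset_union_left K hst).trans hsub, h'⟩
  · intro s t hs ht α K hK h
    obtain ⟨β, hβ, K', hK', hsub, h'⟩ := hs α K hK h
    obtain ⟨γ, hγ, K'', hK'', hsub', h''⟩ := ht β K' hK' h'
    refine ⟨γ, hγ.trans hβ, K'', hK'', ?_, h''⟩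
    intro x hx
    rcases hx with (hx | hx) | hx
    exacts [hsub' (Or.inr (hsub (Or.inl hx))), hsub' (Or.inl hx), hsub' (Or.inr (hsub (Or.inr hx)))]
  · intro x₀ _
    obtain ⟨U, hU, hxU, θ, hθ, hae⟩ := exists_nhds_ae_nondegenerateAt (n := n) x₀
    obtain ⟨L, hL, hxL, hLU⟩ := exists_compact_subset hU hxU
    refine ⟨L, mem_nhdsWithin_of_mem_nhds (mem_interior_iff_mem_nhds.1 hxL), fun α K hK h ↦ ?_⟩
    have hc : Tendsto (fun a : Euc n ↦ (a : Fin n → ℝ)) (𝓝 0) (𝓝 0) :=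
      (PiLp.continuous_ofLp 2 _).tendsto (0 : Euc n)
    -- Almost every parameter is good on `U`, so good parameters are dense and some lie in the
    -- neighbourhood of 0 that keeps `K` good.
    obtain ⟨a, ha, haU⟩ := (MeasureTheory.Measure.dense_of_ae (hae α)).inter_nhds_nonempty
      (hc.eventually (eventually_forall_family_nondegenerateAt hK α θ h))
    refine ⟨family α θ a, by simp [cohomologyClass_family, hθ], L ∪ K, hL.union hK, subset_rfl,
      fun x hx ↦ hx.elim (fun hx ↦ ?_) fun hx ↦ ?_⟩
    · exact ha x (hLU hx)
    · exact haU x hx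

/-- At a non-degenerate zero the derivative of the coefficients is injective, hence bounded below,
so the zero is isolated. Compactness then gives finiteness. -/
theorem finite_zeros [CompactSpace M] {α : OneForm n M} (hα : IsClosedForm α) (h : IsMorse α) :
    {x | α.at x = 0}.Finite := by
  have : (univ ∩ {x | α.at x = 0}).Finite := by
    refine isCompact_univ.induction_on (p := fun s ↦ (s ∩ {x | α.at x = 0}).Finite) (by simp)
      (fun s t hst ht ↦ ht.subset (inter_subset_inter_left _ hst))
      (fun s t hs ht ↦ by rw [union_inter_distrib_right]; exact hs.union ht) fun x₀ _ ↦ ?_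
    have key : ∀ᶠ x in 𝓝[≠] x₀, α.at x ≠ 0 := by
      by_cases h0 : α.at x₀ = 0
      · have hi := (hessian_nondegenerate_iff hα (mem_extChartAt_source x₀) h0).1 (h x₀ h0)
        obtain ⟨C, -, hC⟩ := LinearMap.exists_antilipschitzWith
          (fderiv ℝ (localRep α x₀) (extChartAt (𝓡 n) x₀ x₀) : Euc n →ₗ[ℝ] (Euc n →L[ℝ] ℝ))
          (LinearMap.ker_eq_bot.2 hi)
        have hne := (localRep_differentiableAt α x₀
          (mem_extChartAt_target x₀)).hasFDerivAt.eventually_ne (c := 0)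
            ⟨C, hC⟩
        have ht : Tendsto (extChartAt (𝓡 n) x₀) (𝓝[≠] x₀) (𝓝[≠] (extChartAt (𝓡 n) x₀ x₀)) := by
          refine tendsto_nhdsWithin_iff.2 ⟨(continuousAt_extChartAt x₀).mono_left
            nhdsWithin_le_nhds, ?_⟩
          filter_upwards [self_mem_nhdsWithin,
            mem_nhdsWithin_of_mem_nhds (extChartAt_source_mem_nhds (I := 𝓡 n) x₀)] with x hx hxs he
          exact hx ((extChartAt (𝓡 n) x₀).injOn hxs (mem_extChartAt_source x₀) he)
        filter_upwards [ht.eventually hne,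
          mem_nhdsWithin_of_mem_nhds (extChartAt_source_mem_nhds (I := 𝓡 n) x₀)] with x hx hxs hz
        exact hx ((localRep_eq_zero_iff α hxs).2 hz)
      -- With no parameters the family is just `α`, and the statement is the openness of the
      -- non-vanishing locus.
      · have := eventually_family_ne_zero (⟨α, hα⟩ : closedForms n M) (ι := Empty) (t := 0)
          (fun j ↦ j.elim) (x₀ := x₀) (by rwa [family_zero])
        have hc : Tendsto (fun x : M ↦ ((0 : Empty → ℝ), x)) (𝓝 x₀) (𝓝 (0, x₀)) :=
          (Continuous.prodMk_right (0 : Empty → ℝ)).tendsto x₀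
        refine ((hc.eventually this).filter_mono nhdsWithin_le_nhds).mono fun x hx hz ↦ hx ?_
        simpa [family] using hz
    refine ⟨{x | x ≠ x₀ → α.at x ≠ 0}, mem_nhdsWithin_of_mem_nhds
      (eventually_nhdsWithin_iff.1 key), (finite_singleton x₀).subset fun x hx ↦ ?_⟩
    by_contra hne
    exact hx.1 hne hx.2
  simpa using this

theorem morseNumbers_nonempty [T2Space M] [CompactSpace M] (i : ℕ) (ξ : H1 n M) :
    (morseNumbers i ξ).Nonempty := by
  obtain ⟨α, rfl⟩ := cohomologyClass_surjective ξ
  obtain ⟨β, hβ, h⟩ := exists_isMorse α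
  have hf : (zerosOfIndex (β : OneForm n M) i).Finite :=
    (finite_zeros β.2 h).subset fun x hx ↦ hx.1
  exact ⟨_, β, hβ, h, hf.encard_eq_coe⟩

theorem isLeast_mrankClass [T2Space M] [CompactSpace M] (i : ℕ) (ξ : H1 n M) :
    IsLeast (morseNumbers i ξ) (mrankClass i ξ) :=
  ⟨Nat.sInf_mem (morseNumbers_nonempty i ξ), fun _ hk ↦ Nat.sInf_le hk⟩

end Existence


/-! ### Persistence of Morse numbers and upper semi-continuity -/

section Semicontinuity

variable {n : ℕ} {M : Type*} [TopologicalSpace M] [ChartedSpace (Euc n) M]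
  [IsManifold (𝓡 n) ∞ M]

/-- Induction on the finite set: a primitive near the new point is blended with the function already
built, by a bump function equal to 1 near that point and supported away from the others. -/
theorem exists_primitive_near_finite [T2Space M] (α : closedForms n M) {Z : Set M}
    (hZ : Z.Finite) : ∃ g : M → ℝ, ContMDiff (𝓡 n) 𝓘(ℝ, ℝ) ∞ g ∧
      ∀ p ∈ Z, ∀ᶠ x in 𝓝 p, (α : OneForm n M).at x = diff g x := by
  induction Z, hZ using Set.Finite.induction_on with
  | empty => exact ⟨fun _ ↦ 0, contMDiff_const, by simp⟩
  | @insert p Z hp hZ ih =>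
    obtain ⟨g, hg, hgZ⟩ := ih
    obtain ⟨U, hU, hpU, h⟩ := exists_nhds_primitive (n := n) p
    obtain ⟨f, hf, hfU⟩ := h α α.2
    obtain ⟨χ, -, hχ⟩ := (SmoothBumpFunction.nhds_basis_tsupport (I := 𝓡 n) p).mem_iff.1
      (hZ.isClosed.isOpen_compl.mem_nhds hp)
    refine ⟨fun x ↦ χ x * f x + (1 - χ x) * g x,
      (χ.contMDiff.mul hf).add ((contMDiff_const.sub χ.contMDiff).mul hg), fun q hq ↦ ?_⟩
    rcases hq with rfl | hq
    · have h1 : (fun x ↦ χ x * f x + (1 - χ x) * g x) =ᶠ[𝓝 q] f := by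
        filter_upwards [χ.eventuallyEq_one] with x hx
        simp [hx]
      filter_upwards [h1.eventuallyEq_nhds, hU.mem_nhds hpU] with x hx hxU
      rw [hfU x hxU, diff_congr hx]
    · have h1 : (fun x ↦ χ x * f x + (1 - χ x) * g x) =ᶠ[𝓝 q] g := by
        filter_upwards [(isClosed_tsupport χ).isOpen_compl.mem_nhds fun h ↦ hχ h hq] with x hx
        simp [image_eq_zero_of_notMem_tsupport hx]
      filter_upwards [h1.eventuallyEq_nhds, hgZ q hq] with x hx hxq
      rw [hxq, diff_congr hx]

/-- Every class is represented by a form that vanishes near a given finite set. -/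
theorem exists_representative_zero_near_finite [T2Space M] (ξ : H1 n M) {Z : Set M}
    (hZ : Z.Finite) : ∃ θ : closedForms n M, cohomologyClass θ = ξ ∧
      ∀ p ∈ Z, ∀ᶠ x in 𝓝 p, (θ : OneForm n M).at x = 0 := by
  obtain ⟨α, rfl⟩ := cohomologyClass_surjective ξ
  obtain ⟨g, hg, h⟩ := exists_primitive_near_finite α hZ
  refine ⟨α - dForm g hg, by simp, fun p hp ↦ (h p hp).mono fun x hx ↦ ?_⟩
  simp [hx]

theorem hessian_congr {α β : OneForm n M} {x : M} (h : ∀ᶠ y in 𝓝 x, α.at y = β.at y) :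
    hessian α x = hessian β x := by
  unfold hessian
  rw [(localRep_congr (mem_extChartAt_target (I := 𝓡 n) x) (by rwa [extChartAt_to_inv])).fderiv_eq]

/-- Forms that have the same zeros, and agree near these, have the same Morse data. -/
theorem isMorse_and_zerosOfIndex_congr {α β : OneForm n M} (h0 : ∀ x, β.at x = 0 → α.at x = 0)
    (h : ∀ x, α.at x = 0 → ∀ᶠ y in 𝓝 x, β.at y = α.at y) (hα : IsMorse α) (i : ℕ) :
    IsMorse β ∧ zerosOfIndex β i = zerosOfIndex α i := by
  refine ⟨fun x hx ↦ ?_, ?_⟩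
  · rw [hessian_congr (h x (h0 x hx))]
    exact hα x (h0 x hx)
  · ext x
    have key : β.at x = 0 ↔ α.at x = 0 :=
      ⟨h0 x, fun hx ↦ (h x hx).self_of_nhds.trans hx⟩
    constructor
    · rintro ⟨hx, hi⟩
      refine ⟨key.1 hx, ?_⟩
      rwa [morseIndex, ← hessian_congr (h x (key.1 hx))]
    · rintro ⟨hx, hi⟩
      refine ⟨key.2 hx, ?_⟩
      rwa [morseIndex, hessian_congr (h x hx)]

/-- The module topology makes linear maps out of `H1` continuous and surjective linear maps onto it
open. -/
instance : IsModuleTopology ℝ (H1 n M) := ⟨rfl⟩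

instance : ContinuousAdd (H1 n M) := IsModuleTopology.toContinuousAdd ℝ _

instance : ContinuousSMul ℝ (H1 n M) := IsModuleTopology.toContinuousSMul ℝ _

/-- The perturbing forms represent a basis of H¹ and vanish on an open set `O` containing the zeros.
On `O` the form is unchanged; on the compact complement it stays non-zero for small parameters. -/
theorem eventually_mem_morseNumbers [T2Space M] [CompactSpace M] [Module.Finite ℝ (H1 n M)]
    {i k : ℕ} {ξ : H1 n M} (hk : k ∈ morseNumbers i ξ) :
    ∀ᶠ η in 𝓝 ξ, k ∈ morseNumbers i η := by
  obtain ⟨α, rfl, hα, hcard⟩ := hk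
  have hZ := finite_zeros α.2 hα
  let e := Module.finBasis ℝ (H1 n M)
  choose θ hθ hθZ using fun j ↦ exists_representative_zero_near_finite (e j) hZ
  let O : Set M := interior {x | ∀ j, (θ j : OneForm n M).at x = 0}
  have hO (p : M) (hp : (α : OneForm n M).at p = 0) : p ∈ O :=
    mem_interior_iff_mem_nhds.2 (eventually_all.2 fun j ↦ hθZ j p hp)
  have hfam : ∀ᶠ t in 𝓝 (0 : Fin (Module.finrank ℝ (H1 n M)) → ℝ),
      ∀ x ∈ Oᶜ, (family α θ t : OneForm n M).at x ≠ 0 :=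
    eventually_forall_family_ne_zero isOpen_interior.isClosed_compl.isCompact α θ
      fun x hx h0 ↦ hx (hO x h0)
  have hgood : ∀ᶠ t in 𝓝 (0 : Fin (Module.finrank ℝ (H1 n M)) → ℝ),
      k ∈ morseNumbers i (cohomologyClass (family α θ t)) := by
    filter_upwards [hfam] with t ht
    have heq (x : M) (hx : x ∈ O) :
        (family α θ t : OneForm n M).at x = (α : OneForm n M).at x := by
      rw [family_at, Finset.sum_eq_zero fun j _ ↦ ?_, add_zero]
      have := interior_subset hx j
      rw [this, smul_zero]
    obtain ⟨h1, h2⟩ := isMorse_and_zerosOfIndex_congr (α := (α : OneForm n M))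
      (β := (family α θ t : OneForm n M)) (fun x hx ↦ by
        have hxO : x ∈ O := by
          by_contra hxO
          exact ht x hxO hx
        rwa [← heq x hxO])
      (fun x hx ↦ eventually_of_mem (isOpen_interior.mem_nhds (hO x hx)) heq) hα i
    exact ⟨_, rfl, h1, by rw [h2, hcard]⟩
  -- Openness of the parametrisation turns "all small parameters" into "all nearby classes".
  have hopen : IsOpenMap (fun t : Fin (Module.finrank ℝ (H1 n M)) → ℝ ↦
      cohomologyClass α + e.equivFun.symm t) :=
    (isOpenMap_add_left (cohomologyClass α)).comp
      (IsModuleTopology.isOpenMap_of_surjective (R := ℝ)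
        (φ := e.equivFun.symm.toLinearMap) e.equivFun.symm.surjective)
  have h := hopen.image_mem_nhds hgood
  simp only [map_zero, add_zero] at h
  refine mem_of_superset h ?_
  rintro _ ⟨t, ht, rfl⟩
  have ht' : k ∈ morseNumbers i (cohomologyClass (family α θ t)) := ht
  rw [cohomologyClass_family] at ht'
  simpa [hθ, Module.Basis.equivFun_symm_apply] using ht'

theorem isOpen_S_iff {A : Set (S n M)} :
    IsOpen A ↔ ∃ B : Set (H1 n M), IsOpen B ∧ ∀ ξ (hξ : ξ ≠ 0), ξ ∈ B ↔ toS ξ hξ ∈ A := by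
  have h : IsOpen A ↔ IsOpen
      ((fun ξ : {ξ : H1 n M // ξ ≠ 0} ↦ (toS ξ.1 ξ.2 : S n M)) ⁻¹' A) := Iff.rfl
  rw [h, isOpen_induced_iff]
  refine exists_congr fun B ↦ and_congr_right fun _ ↦ ?_
  simp [Set.ext_iff]

theorem S_ind {p : S n M → Prop} (h : ∀ ξ (hξ : ξ ≠ 0), p (toS ξ hξ)) (x : S n M) : p x :=
  Module.Ray.ind ℝ h x

theorem isOpen_mrank_le [T2Space M] [CompactSpace M] [Module.Finite ℝ (H1 n M)] (i k : ℕ) :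
    IsOpen {x : S n M | mrank i x ≤ k} := by
  rw [isOpen_S_iff]
  -- The class 0 need not be removed: persistence of Morse numbers holds there too.
  refine ⟨{ξ | mrankClass i ξ ≤ k}, isOpen_iff_mem_nhds.2 fun ξ hξ ↦ ?_, fun ξ hξ ↦ Iff.rfl⟩
  filter_upwards [eventually_mem_morseNumbers (isLeast_mrankClass i ξ).1] with η hη
  exact ((isLeast_mrankClass i η).2 hη).trans hξ

theorem upperSemicontinuous_mrank [T2Space M] [CompactSpace M] [Module.Finite ℝ (H1 n M)]
    (i : ℕ) : UpperSemicontinuous (mrank i : S n M → ℕ) := by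
  intro x y hy
  filter_upwards [(isOpen_mrank_le i (mrank i x)).mem_nhds
    (show mrank i x ≤ mrank i x from le_rfl)] with z hz
  exact lt_of_le_of_lt hz hy

theorem isOpen_minimalPoints [T2Space M] [CompactSpace M] [Module.Finite ℝ (H1 n M)] (i : ℕ) :
    IsOpen (minimalPoints i : Set (S n M)) := by
  refine isOpen_iff_mem_nhds.2 fun x hx ↦ ?_
  filter_upwards [(isOpen_mrank_le i (mrank i x)).mem_nhds
    (show mrank i x ≤ mrank i x from le_rfl)] with z hz y
  exact le_trans hz (hx y)

end Semicontinuity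


/-! ### Čech cocycles and the finite dimension of H¹ -/

section Cocycles

variable {n : ℕ} {M : Type*} [TopologicalSpace M] [ChartedSpace (Euc n) M]
  [IsManifold (𝓡 n) ∞ M]

theorem eventually_eq_of_diff_eq_zero {h : M → ℝ} (hh : ContMDiff (𝓡 n) 𝓘(ℝ, ℝ) ∞ h) {W : Set M}
    (hW : IsOpen W) (h0 : ∀ x ∈ W, (diff h x : TangentSpace (𝓡 n) x →L[ℝ] ℝ) = 0) {x₀ : M}
    (hx₀ : x₀ ∈ W) : ∀ᶠ x in 𝓝 x₀, h x = h x₀ := by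
  have hc : ContinuousAt (extChartAt (𝓡 n) x₀).symm (extChartAt (𝓡 n) x₀ x₀) :=
    continuousAt_extChartAt_symm'' (mem_extChartAt_target x₀)
  have hV : (extChartAt (𝓡 n) x₀).target ∩ (extChartAt (𝓡 n) x₀).symm ⁻¹' W ∈
      𝓝 (extChartAt (𝓡 n) x₀ x₀) :=
    inter_mem ((isOpen_extChartAt_target (I := 𝓡 n) x₀).mem_nhds (mem_extChartAt_target x₀))
      (hc.preimage_mem_nhds (by rw [extChartAt_to_inv]; exact hW.mem_nhds hx₀))
  obtain ⟨r, hr, hb⟩ := Metric.mem_nhds_iff.1 hV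
  have hd (y : Euc n) (hy : y ∈ Metric.ball (extChartAt (𝓡 n) x₀ x₀) r) :
      fderiv ℝ (h ∘ (extChartAt (𝓡 n) x₀).symm) y = 0 := by
    rw [← mfderiv_eq_fderiv, mfderiv_comp y (hh.mdifferentiable (by simp) _)
      (mdifferentiableAt_extChartAt_symm (hb hy).1)]
    have := h0 _ (hb hy).2
    unfold diff at this
    rw [this]
    rfl
  have hconst (y : Euc n) (hy : y ∈ Metric.ball (extChartAt (𝓡 n) x₀ x₀) r) :=
    Metric.isOpen_ball.is_const_of_fderiv_eq_zero (𝕜 := ℝ)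
    (convex_ball (extChartAt (𝓡 n) x₀ x₀) r).isPreconnected
    (fun y hy ↦ ((contDiffAt_comp_extChartAt_symm hh (hb hy).1).differentiableAt
      (by simp)).differentiableWithinAt) hd hy
      (Metric.mem_ball_self (x := extChartAt (𝓡 n) x₀ x₀) hr)
  filter_upwards [extChartAt_source_mem_nhds (I := 𝓡 n) x₀,
    (continuousAt_extChartAt x₀).preimage_mem_nhds (Metric.ball_mem_nhds
      (extChartAt (𝓡 n) x₀ x₀) hr)] with x hxs hxb
  have := hconst _ hxb
  simpa only [Function.comp_apply, (extChartAt (𝓡 n) x₀).left_inv hxs, extChartAt_to_inv] using this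

theorem contMDiff_const_mul {f : M → ℝ} (hf : ContMDiff (𝓡 n) 𝓘(ℝ, ℝ) ∞ f) (r : ℝ) :
    ContMDiff (𝓡 n) 𝓘(ℝ, ℝ) ∞ fun x ↦ r * f x :=
  contMDiff_const.mul hf

theorem sub_eq_sub_of_diff_eq {f g : M → ℝ} (hf : ContMDiff (𝓡 n) 𝓘(ℝ, ℝ) ∞ f)
    (hg : ContMDiff (𝓡 n) 𝓘(ℝ, ℝ) ∞ g) {W : Set M} (hW : IsOpen W) (hWc : IsPreconnected W)
    (h : ∀ x ∈ W, (diff f x : TangentSpace (𝓡 n) x →L[ℝ] ℝ) = diff g x) {x y : M} (hx : x ∈ W)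
    (hy : y ∈ W) : f x - g x = f y - g y := by
  have hfg : ContMDiff (𝓡 n) 𝓘(ℝ, ℝ) ∞ fun x ↦ f x + -1 * g x := 
    hf.add (contMDiff_const_mul hg _)
  have h0 (x : M) (hx : x ∈ W) :
      (diff (fun x ↦ f x + -1 * g x) x : TangentSpace (𝓡 n) x →L[ℝ] ℝ) = 0 := by
    rw [diff_add hf (contMDiff_const_mul hg _), diff_const_mul hg, h x hx]
    module
  have hl : IsLocallyConstant fun x : W ↦ f x + -1 * g x := by
    rw [IsLocallyConstant.iff_eventually_eq]
    intro x
    exact continuousAt_subtype_val.eventually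
      (eventually_eq_of_diff_eq_zero (n := n) hfg hW h0 x.2)
  have : PreconnectedSpace W := isPreconnected_iff_preconnectedSpace.1 hWc
  have h1 := hl.apply_eq_of_preconnectedSpace ⟨x, hx⟩ ⟨y, hy⟩
  dsimp only at h1
  linarith

variable (n M) in
/-- A finite open cover with a partition of unity, such that each closed form has primitives on
the sets of the cover whose differences are constant on the overlaps. -/
structure GoodCover (K : Type*) [Fintype K] where
  /-- The sets of the cover. -/
  set : K → Set M
  isOpen_set : ∀ k, IsOpen (set k)
  exists_mem : ∀ x, ∃ k, x ∈ set k
  /-- The partition of unity. -/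
  ρ : K → M → ℝ
  contMDiff_ρ : ∀ k, ContMDiff (𝓡 n) 𝓘(ℝ, ℝ) ∞ (ρ k)
  mem_of_ne_zero : ∀ k x, ρ k x ≠ 0 → x ∈ set k
  sum_ρ : ∀ x, ∑ k, ρ k x = 1
  exists_primitives : ∀ α : closedForms n M, ∃ f : K → M → ℝ,
    (∀ k, ContMDiff (𝓡 n) 𝓘(ℝ, ℝ) ∞ (f k)) ∧
    (∀ k, ∀ x ∈ set k, (α : OneForm n M).at x = diff (f k) x) ∧
    ∀ k l, ∃ c : ℝ, ∀ x ∈ set k, x ∈ set l → f k x - f l x = c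

-- Take connected sets inside balls of radius a third of a Lebesgue number of the cover by
-- neighbourhoods with primitives. Two of them that meet lie in a common neighbourhood `U p`. Each
-- local primitive differs by a constant from the one on `U p`, so their difference is constant on
-- the overlap, even if the overlap is disconnected.
variable (n M) in
theorem exists_goodCover [T2Space M] [CompactSpace M] :
    ∃ t : Finset M, Nonempty (GoodCover n M t) := by
  have : SecondCountableTopology M := ChartedSpace.secondCountable_of_sigmaCompact (Euc n) M
  have : LocallyConnectedSpace M := ChartedSpace.locallyConnectedSpace (Euc n) M
  let _ : MetricSpace M := TopologicalSpace.metrizableSpaceMetric M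
  choose U hU hxU hprim using exists_nhds_primitive (n := n) (M := M)
  obtain ⟨δ, hδ, hball⟩ := lebesgue_number_lemma_of_metric (isCompact_univ (X := M)) hU
    fun x _ ↦ mem_iUnion.2 ⟨x, hxU x⟩
  have hV (x : M) := locallyConnectedSpace_iff_subsets_isOpen_isConnected.1 this x _
    (Metric.ball_mem_nhds x (show 0 < δ / 3 by positivity))
  choose V hVb hVo hxV hVc using hV
  obtain ⟨t, ht⟩ := isCompact_univ.elim_finite_subcover V hVo fun x _ ↦ mem_iUnion.2 ⟨x, hxV x⟩
  have hcov : (univ : Set M) ⊆ ⋃ k : t, V k := by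
    simpa [iUnion_subtype] using ht
  obtain ⟨ρ, hρ⟩ := SmoothPartitionOfUnity.exists_isSubordinate (𝓡 n) isClosed_univ
    (fun k : t ↦ V k) (fun k ↦ hVo k) hcov
  refine ⟨t, ⟨{
    set := fun k ↦ V k
    isOpen_set := fun k ↦ hVo k
    exists_mem := fun x ↦ by simpa using hcov (mem_univ x)
    ρ := fun k ↦ ρ k
    contMDiff_ρ := fun k ↦ (ρ k).contMDiff
    mem_of_ne_zero := fun k x hx ↦ hρ k (subset_tsupport _ hx)
    sum_ρ := fun x ↦ by rw [← finsum_eq_sum_of_fintype, ρ.sum_eq_one (mem_univ x)]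
    exists_primitives := fun α ↦ ?_ }⟩⟩
  have hV3 (k l : M) (hkl : (V k ∩ V l).Nonempty) : ∃ m, V k ∪ V l ⊆ U m := by
    obtain ⟨z, hzk, hzl⟩ := hkl
    obtain ⟨m, hm⟩ := hball k (mem_univ k)
    refine ⟨m, Subset.trans ?_ hm⟩
    rintro x (hx | hx)
    · exact (Metric.ball_subset_ball (by linarith)) (hVb k hx)
    · have h1 := Metric.mem_ball.1 (hVb k hzk)
      have h2 := Metric.mem_ball.1 (hVb l hzl)
      have h3 := Metric.mem_ball.1 (hVb l hx)
      rw [Metric.mem_ball]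
      have h4 := dist_triangle4_right x k z l
      have h5 := dist_triangle x l z
      have h6 := dist_triangle x z k
      rw [dist_comm l z] at h5
      linarith
  have hVU (k : M) : ∃ m, V k ⊆ U m :=
    (hV3 k k ⟨k, hxV k, hxV k⟩).imp fun m hm ↦ subset_union_left.trans hm
  choose f hf hfU using fun m ↦ hprim m α α.2
  choose m hm using hVU
  refine ⟨fun k ↦ f (m k), fun k ↦ hf _, fun k x hx ↦ hfU _ _ (hm k hx), fun k l ↦ ?_⟩
  by_cases hkl : (V k ∩ V l).Nonempty
  · obtain ⟨p, hp⟩ := hV3 k l hkl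
    obtain ⟨z, hzk, hzl⟩ := hkl
    refine ⟨f (m k) z - f (m l) z, fun x hxk hxl ↦ ?_⟩
    have h1 (j : M) (hj : V j ⊆ U p) (hxj : x ∈ V j) (hzj : z ∈ V j) :
        f (m j) x - f p x = f (m j) z - f p z :=
      sub_eq_sub_of_diff_eq (n := n) (hf _) (hf _) (hVo j) (hVc j).isPreconnected
        (fun y hy ↦ (hfU _ y (hm j hy)).symm.trans (hfU p y (hj hy))) hxj hzj
    have h2 := h1 k (subset_union_left.trans hp) hxk hzk
    have h3 := h1 l (subset_union_right.trans hp) hxl hzl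
    linarith
  · exact ⟨0, fun x hxk hxl ↦ absurd ⟨x, hxk, hxl⟩ hkl⟩

namespace GoodCover

variable {K : Type*} [Fintype K] (C : GoodCover n M K)

/-- The condition on `1`-cocycles of the cover with values in an abelian group. -/
def IsCocycle {A : Type*} [AddCommGroup A] (c : K → K → A) : Prop :=
  ∀ k l m, (∃ x, x ∈ C.set k ∧ x ∈ C.set l ∧ x ∈ C.set m) → c k m = c k l + c l m

/-- The space of real `1`-cocycles of the cover. -/
def cocycles : Submodule ℝ (K → K → ℝ) where
  carrier := {c | C.IsCocycle c}
  zero_mem' := fun k l m _ ↦ by simp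
  add_mem' := by
    intro c d hc hd k l m h
    simp only [Pi.add_apply, hc k l m h, hd k l m h]
    ring
  smul_mem' := by
    intro r c hc k l m h
    simp only [Pi.smul_apply, hc k l m h, smul_add]

/-- The local primitive of the form defined by a cocycle. -/
def localPrimitive (c : K → K → ℝ) (k : K) (x : M) : ℝ := ∑ l, c k l * C.ρ l x

theorem contMDiff_localPrimitive (c : K → K → ℝ) (k : K) :
    ContMDiff (𝓡 n) 𝓘(ℝ, ℝ) ∞ (C.localPrimitive c k) :=
  contMDiff_finsetSum fun l _ ↦ contMDiff_const.mul (C.contMDiff_ρ l)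

/-- The weights sum to 1, and wherever `ρ m` is non-zero at `x` the three sets meet, so the cocycle
relation applies term by term. -/
theorem localPrimitive_eq {c : K → K → ℝ} (hc : C.IsCocycle c) {k l : K} {x : M}
    (hk : x ∈ C.set k) (hl : x ∈ C.set l) :
    C.localPrimitive c k x = C.localPrimitive c l x + c k l := by
  have h : c k l = ∑ m, c k l * C.ρ m x := by rw [← Finset.mul_sum, C.sum_ρ, mul_one]
  rw [h]
  simp only [localPrimitive]
  rw [← Finset.sum_add_distrib]
  refine Finset.sum_congr rfl fun m _ ↦ ?_
  by_cases hm : C.ρ m x = 0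
  · simp [hm]
  · rw [hc k l m ⟨x, hk, hl, C.mem_of_ne_zero m x hm⟩]
    ring

theorem diff_localPrimitive (c : K → K → ℝ) (k : K) (x : M) :
    (diff (C.localPrimitive c k) x : TangentSpace (𝓡 n) x →L[ℝ] ℝ) =
      ∑ l, c k l • diff (C.ρ l) x := by
  unfold localPrimitive
  rw [diff_sum _ fun l ↦ contMDiff_const_mul (C.contMDiff_ρ l) _]
  exact Finset.sum_congr rfl fun l _ ↦ diff_const_mul (C.contMDiff_ρ l) _ _

theorem diff_localPrimitive_eq {c : K → K → ℝ} (hc : C.IsCocycle c) {k l : K} {x : M}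
    (hk : x ∈ C.set k) (hl : x ∈ C.set l) :
    (diff (C.localPrimitive c k) x : TangentSpace (𝓡 n) x →L[ℝ] ℝ) =
      diff (C.localPrimitive c l) x := by
  have h : C.localPrimitive c k =ᶠ[𝓝 x] fun y ↦ C.localPrimitive c l y + c k l := by
    filter_upwards [(C.isOpen_set k).mem_nhds hk, (C.isOpen_set l).mem_nhds hl] with y hyk hyl
    exact C.localPrimitive_eq hc hyk hyl
  rw [diff_congr h, diff_add (C.contMDiff_localPrimitive c l) contMDiff_const, diff_const, add_zero]

/-- A set of the cover that contains a given point. -/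
def index (x : M) : K := (C.exists_mem x).choose

theorem mem_index (x : M) : x ∈ C.set (C.index x) := (C.exists_mem x).choose_spec

/-- The closed form defined by a cocycle. -/
def cocycleForm : C.cocycles →ₗ[ℝ] closedForms n M where
  toFun c := ⟨glue (fun x ↦ diff (C.localPrimitive c (C.index x)) x) fun x ↦
    ⟨C.localPrimitive c (C.index x), C.contMDiff_localPrimitive _ _, by
      filter_upwards [(C.isOpen_set _).mem_nhds (C.mem_index x)] with y hy
      exact C.diff_localPrimitive_eq c.2 (C.mem_index y) hy⟩, glue_isClosedForm _ _⟩
  map_add' c d := Subtype.ext <| OneForm.ext fun x ↦ by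
    simp [diff_localPrimitive, add_smul, Finset.sum_add_distrib]
  map_smul' r c := Subtype.ext <| OneForm.ext fun x ↦ by
    simp [diff_localPrimitive, mul_smul, Finset.smul_sum]

theorem cocycleForm_at (c : C.cocycles) {k : K} {x : M} (hx : x ∈ C.set k) :
    (C.cocycleForm c : OneForm n M).at x = diff (C.localPrimitive c k) x :=
  C.diff_localPrimitive_eq c.2 (C.mem_index x) hx

/-- The cohomology class defined by a cocycle. -/
def cocycleClass : C.cocycles →ₗ[ℝ] H1 n M := cohomologyClass.comp C.cocycleForm

theorem cocycleClass_surjective : Function.Surjective C.cocycleClass := by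
  classical
  intro ξ
  obtain ⟨α, rfl⟩ := cohomologyClass_surjective ξ
  obtain ⟨f, hf, hfα, hc⟩ := C.exists_primitives α
  choose c hc using hc
  let c' : K → K → ℝ := fun k l ↦ if ∃ x, x ∈ C.set k ∧ x ∈ C.set l then c k l else 0
  have hc' {k l : K} {x : M} (hk : x ∈ C.set k) (hl : x ∈ C.set l) :
      c' k l = f k x - f l x := by
    simp only [c']
    rw [if_pos ⟨x, hk, hl⟩, hc k l x hk hl]
  have hcc : C.IsCocycle c' := by
    rintro k l m ⟨x, hk, hl, hm⟩
    rw [hc' hk hm, hc' hk hl, hc' hl hm]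
    ring
  -- On the k-th set, f k = ∑ f k · ρ l = ∑ (c' k l + f l) · ρ l, which is the local primitive of
  -- the cocycle plus `F`. So `α` differs from the cocycle form by dF.
  let F : M → ℝ := fun x ↦ ∑ l, f l x * C.ρ l x
  have hF : ContMDiff (𝓡 n) 𝓘(ℝ, ℝ) ∞ F :=
    contMDiff_finsetSum fun l _ ↦ (hf l).mul (C.contMDiff_ρ l)
  have heq : C.cocycleForm ⟨c', hcc⟩ + dForm F hF = α := by
    refine Subtype.ext (OneForm.ext fun x ↦ ?_)
    have hx := C.mem_index x
    rw [Submodule.coe_add, at_add, C.cocycleForm_at _ hx, dForm_at,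
      ← diff_add (C.contMDiff_localPrimitive _ _) hF, hfα _ x hx]
    refine diff_congr ?_
    filter_upwards [(C.isOpen_set _).mem_nhds hx] with y hy
    simp only [localPrimitive, F]
    rw [← Finset.sum_add_distrib, ← mul_one (f _ y), ← C.sum_ρ y, Finset.mul_sum]
    refine Finset.sum_congr rfl fun l _ ↦ ?_
    by_cases hl : C.ρ l y = 0
    · simp [hl]
    · rw [hc' hy (C.mem_of_ne_zero l y hl)]
      ring
  refine ⟨⟨c', hcc⟩, ?_⟩
  rw [← heq, map_add, cohomologyClass_dForm, add_zero]
  rfl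

end GoodCover

variable (n M) in
theorem finite_H1 [T2Space M] [CompactSpace M] : Module.Finite ℝ (H1 n M) := by
  obtain ⟨t, ⟨C⟩⟩ := exists_goodCover n M
  exact Module.Finite.of_surjective C.cocycleClass C.cocycleClass_surjective

end Cocycles


/-! ### Integral cocycles, integral periods, and density of rational points -/

section Rational

variable {n : ℕ} {M : Type*} [TopologicalSpace M] [ChartedSpace (Euc n) M]
  [IsManifold (𝓡 n) ∞ M]

theorem hasDerivAt_comp_curve {f : M → ℝ} (hf : ContMDiff (𝓡 n) 𝓘(ℝ, ℝ) ∞ f) {γ : ℝ → M}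
    (hγ : ContMDiff 𝓘(ℝ, ℝ) (𝓡 n) ∞ γ) (t : ℝ) :
    HasDerivAt (f ∘ γ) (diff f (γ t) (mfderiv 𝓘(ℝ, ℝ) (𝓡 n) γ t (1 : ℝ))) t := by
  have h1 : MDifferentiableAt 𝓘(ℝ, ℝ) 𝓘(ℝ, ℝ) (f ∘ γ) t :=
    (hf.comp hγ).mdifferentiable (by simp) t
  have h2 := mfderiv_comp t (hf.mdifferentiable (by simp) (γ t)) (hγ.mdifferentiable (by simp) t)
  rw [mfderiv_eq_fderiv] at h2
  have h3 := h1.differentiableAt.hasDerivAt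
  rw [← fderiv_apply_one_eq_deriv, h2] at h3
  exact h3

namespace GoodCover

variable {K : Type*} [Fintype K] (C : GoodCover n M K)

open Complex in
/-- The form of an integral cocycle has integral periods. -/
theorem exists_period_eq_int (c : C.cocycles) (hc : ∀ k l, ∃ m : ℤ, (c : K → K → ℝ) k l = m)
    {γ : ℝ → M} (hγ : ContMDiff 𝓘(ℝ, ℝ) (𝓡 n) ∞ γ) (hper : Function.Periodic γ 1) :
    ∃ m : ℤ, period (C.cocycleForm c : OneForm n M) γ = m := by
  set w : ℝ → ℝ := fun t ↦ (C.cocycleForm c : OneForm n M).at (γ t)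
    (mfderiv 𝓘(ℝ, ℝ) (𝓡 n) γ t (1 : ℝ)) with hw
  have hnear (t : ℝ) : ∀ᶠ s in 𝓝 t, γ s ∈ C.set (C.index (γ t)) :=
    hγ.continuous.continuousAt.eventually ((C.isOpen_set _).mem_nhds (C.mem_index (γ t)))
  have hwd (k : K) (t : ℝ) (ht : γ t ∈ C.set k) :
      HasDerivAt (C.localPrimitive c k ∘ γ) (w t) t := by
    simp only [hw]
    rw [C.cocycleForm_at c ht]
    exact hasDerivAt_comp_curve (C.contMDiff_localPrimitive _ _) hγ t
  have hwc : Continuous w := continuous_iff_continuousAt.2 fun t ↦ by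
    have hsm : ContDiff ℝ ∞ (C.localPrimitive c (C.index (γ t)) ∘ γ) := by
      rw [← contMDiff_iff_contDiff]
      exact (C.contMDiff_localPrimitive _ _).comp hγ
    refine (hsm.continuous_deriv (by simp)).continuousAt.congr ?_
    filter_upwards [hnear t] with s hs
    exact (hwd _ s hs).deriv
  -- The chosen index may jump with `t`, but for an integral cocycle this changes `h` only by
  -- integers. Hence `e` = exp(2πi h) can be computed with any set of the cover and is
  -- differentiable.
  let h : ℝ → ℝ := fun t ↦ C.localPrimitive c (C.index (γ t)) (γ t)
  let e : ℝ → ℂ := fun t ↦ exp (2 * Real.pi * I * h t)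
  have he (k : K) (t : ℝ) (ht : γ t ∈ C.set k) :
      e t = exp (2 * Real.pi * I * (C.localPrimitive c k (γ t) : ℝ)) := by
    obtain ⟨m, hm⟩ := hc (C.index (γ t)) k
    simp only [e, h]
    rw [C.localPrimitive_eq c.2 (C.mem_index (γ t)) ht, hm, Complex.exp_eq_exp_iff_exists_int]
    exact ⟨m, by push_cast; ring⟩
  have hed (t : ℝ) : HasDerivAt e (e t * (2 * Real.pi * I * w t)) t := by
    have h1 := ((hwd _ t (C.mem_index (γ t))).ofReal_comp.const_mul (2 * Real.pi * I)).cexp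
    refine h1.congr_of_eventuallyEq ?_
    filter_upwards [hnear t] with s hs
    exact he _ s hs
  have hint (t : ℝ) : HasDerivAt (fun t ↦ ∫ s in (0 : ℝ)..t, w s) (w t) t :=
    intervalIntegral.integral_hasDerivAt_right (hwc.intervalIntegrable _ _)
      (hwc.stronglyMeasurableAtFilter _ _) hwc.continuousAt
  -- Both `e` and exp(2πi ∫ w) solve y' = 2πi w y, so their quotient `G` is constant. As the loop
  -- closes up, e 1 = e 0, which forces exp(-2πi · period) = 1.
  let G : ℝ → ℂ := fun t ↦ e t * exp (-(2 * Real.pi * I) * (∫ s in (0 : ℝ)..t, w s : ℝ))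
  have hG (t : ℝ) : HasDerivAt G 0 t := by
    refine ((hed t).mul ((hint t).ofReal_comp.const_mul (-(2 * Real.pi * I))).cexp).congr_deriv ?_
    ring
  have hGc : G 1 = G 0 := is_const_of_deriv_eq_zero (fun t ↦ (hG t).differentiableAt)
    (fun t ↦ (hG t).deriv) 1 0
  have hγ1 : γ 1 = γ 0 := by simpa using hper 0
  have he1 : e 1 = e 0 := by simp only [e, h, hγ1]
  simp only [G, he1, intervalIntegral.integral_same, ofReal_zero, mul_zero, Complex.exp_zero] at hGc
  have hexp := mul_left_cancel₀ (Complex.exp_ne_zero _) hGc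
  obtain ⟨m, hm⟩ := Complex.exp_eq_one_iff.1 hexp
  refine ⟨-m, ?_⟩
  have hpi : (2 * Real.pi * I : ℂ) ≠ 0 := Complex.two_pi_I_ne_zero
  have : ((∫ s in (0 : ℝ)..1, w s : ℝ) : ℂ) = -m := by
    refine mul_left_cancel₀ hpi ?_
    linear_combination -hm
  unfold period
  push_cast
  exact_mod_cast this

theorem isIntegral_cocycleClass (c : C.cocycles)
    (hc : ∀ k l, ∃ m : ℤ, (c : K → K → ℝ) k l = m) : IsIntegral (C.cocycleClass c) :=
  ⟨C.cocycleForm c, rfl, fun _ hγ hper ↦ C.exists_period_eq_int c hc hγ hper⟩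

/-- A real cocycle is a real linear combination of integral cocycles. -/
theorem exists_eq_sum_int_cocycles (c : C.cocycles) :
    ∃ (d : ℕ) (r : Fin d → ℝ) (z : Fin d → K → K → ℤ), (∀ s, C.IsCocycle (z s)) ∧
      ∀ k l, (c : K → K → ℝ) k l = ∑ s, r s * z s k l := by
  -- The values of the cocycle generate a finitely generated torsion-free, hence free, subgroup of
  -- ℝ. Coordinates in a ℤ-basis are additive, so they are integral cocycles, and the basis elements
  -- are the real coefficients.
  let L : Submodule ℤ ℝ := Submodule.span ℤ (range fun p : K × K ↦ (c : K → K → ℝ) p.1 p.2)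
  have hL (k l : K) : (c : K → K → ℝ) k l ∈ L := Submodule.subset_span ⟨(k, l), rfl⟩
  have : Module.Finite ℤ L := Module.Finite.span_of_finite ℤ (finite_range _)
  have : Module.Free ℤ L := Module.free_of_finite_type_torsion_free'
  let b := Module.finBasis ℤ L
  refine ⟨_, fun s ↦ b s, fun s k l ↦ b.repr ⟨_, hL k l⟩ s, fun s k l m h ↦ ?_, fun k l ↦ ?_⟩
  · have h1 : (⟨_, hL k m⟩ : L) = ⟨_, hL k l⟩ + ⟨_, hL l m⟩ := Subtype.ext (c.2 k l m h)
    dsimp only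
    rw [h1, map_add, Finsupp.add_apply]
  · have h1 : (c : K → K → ℝ) k l = (∑ s, b.repr ⟨_, hL k l⟩ s • b s : L) :=
      congrArg Subtype.val (b.sum_repr ⟨_, hL k l⟩).symm
    rw [Submodule.coe_sum] at h1
    refine h1.trans (Finset.sum_congr rfl fun s _ ↦ ?_)
    rw [Submodule.coe_smul, zsmul_eq_mul, mul_comm]

end GoodCover

/-- Each nonzero class is a limit of positive rational multiples of integral classes. -/
theorem exists_isIntegral_smul_mem [T2Space M] [CompactSpace M] {ξ : H1 n M} (hξ : ξ ≠ 0)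
    {B : Set (H1 n M)} (hB : B ∈ 𝓝 ξ) :
    ∃ η ∈ B, η ≠ 0 ∧ ∃ N : ℝ, 0 < N ∧ IsIntegral (N • η) := by
  obtain ⟨t, ⟨C⟩⟩ := exists_goodCover n M
  obtain ⟨c, rfl⟩ := C.cocycleClass_surjective ξ
  obtain ⟨d, r, z, hz, hc⟩ := C.exists_eq_sum_int_cocycles c
  let zc : Fin d → C.cocycles := fun s ↦ ⟨fun k l ↦ z s k l, fun k l m h ↦ by
    dsimp only
    rw [hz s k l m h, Int.cast_add]⟩
  have hczc : c = ∑ s, r s • zc s := by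
    ext k l
    simp [hc, zc]
  -- A functional not vanishing on the class gives an open neighbourhood free of 0, so that the
  -- approximating class is non-zero.
  obtain ⟨φ, hφ⟩ := Module.Projective.exists_dual_ne_zero ℝ hξ
  have hφc : Continuous φ := IsModuleTopology.continuous_of_linearMap φ
  have hL : Continuous fun r : Fin d → ℝ ↦ ∑ s, r s • C.cocycleClass (zc s) := by fun_prop
  have hr : ∑ s, r s • C.cocycleClass (zc s) = C.cocycleClass c := by simp [hczc]
  have hmem : (fun r : Fin d → ℝ ↦ ∑ s, r s • C.cocycleClass (zc s)) ⁻¹' (B ∩ {η | φ η ≠ 0}) ∈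
      𝓝 r := by
    refine hL.continuousAt.preimage_mem_nhds ?_
    rw [hr]
    exact inter_mem hB (hφc.continuousAt.eventually_ne hφ)
  have hdense : DenseRange (Pi.map fun _ : Fin d ↦ ((↑) : ℚ → ℝ)) :=
    DenseRange.piMap fun _ ↦ Rat.denseRange_cast
  obtain ⟨_, ⟨hηB, hη0⟩, q, rfl⟩ := mem_closure_iff_nhds.1 (hdense r) _ hmem
  -- The product of the denominators of the rational coefficients makes all of them integral.
  refine ⟨_, hηB, fun h ↦ hη0 (by rw [h, map_zero]), (∏ s, (q s).den : ℕ), ?_, ?_⟩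
  · exact_mod_cast Finset.prod_pos fun s _ ↦ (q s).den_pos
  · have hint (s : Fin d) : ∃ m : ℤ, ((∏ s, (q s).den : ℕ) : ℝ) * (q s : ℝ) = m := by
      obtain ⟨e, he⟩ := Finset.dvd_prod_of_mem (fun s ↦ (q s).den) (Finset.mem_univ s)
      refine ⟨e * (q s).num, ?_⟩
      have h1 : ((q s).den : ℝ) * (q s : ℝ) = (q s).num := by
        exact_mod_cast Rat.den_mul_eq_num (q s)
      rw [he]
      push_cast
      rw [← h1]
      ring
    choose m hm using hint
    have hsum : ((∏ s, (q s).den : ℕ) : ℝ) •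
        ∑ s, (Pi.map (fun _ : Fin d ↦ ((↑) : ℚ → ℝ)) q) s • C.cocycleClass (zc s) =
        C.cocycleClass (∑ s, (m s : ℝ) • zc s) := by
      simp only [map_sum, map_smul, Finset.smul_sum, smul_smul, Pi.map_apply, hm]
    rw [hsum]
    refine C.isIntegral_cocycleClass _ fun k l ↦ ⟨∑ s, m s * z s k l, ?_⟩
    simp [zc]

theorem minimalPoints_subset_closure [T2Space M] [CompactSpace M] (i : ℕ) :
    (minimalPoints i : Set (S n M)) ⊆ closure (minimalPoints i ∩ rationalPoints) := by
  have := finite_H1 n M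
  intro x hx
  rw [mem_closure_iff]
  intro A hA hxA
  -- Intersecting with the open minimal set makes the approximating class minimal as well; scaling
  -- it to an integral class does not move its ray.
  obtain ⟨B, hB, hBA⟩ := isOpen_S_iff.1 (hA.inter (isOpen_minimalPoints (n := n) (M := M) i))
  induction x using S_ind with
  | h ξ hξ =>
    obtain ⟨η, hη, hη0, N, hN, hint⟩ := exists_isIntegral_smul_mem hξ
      (hB.mem_nhds ((hBA ξ hξ).2 ⟨hxA, hx⟩))
    obtain ⟨hA', hmin⟩ := (hBA η hη0).1 hη
    refine ⟨toS η hη0, hA', hmin, N • η, smul_ne_zero hN.ne' hη0, ?_, hint⟩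
    exact (ray_pos_smul hη0 hN _).symm

end Rational

end MorseRank

end

theorem mainTheorem4 (n : ℕ) (M : Type*) [TopologicalSpace M] [T2Space M] [CompactSpace M]
    [ChartedSpace (EuclideanSpace ℝ (Fin n)) M] [IsManifold (𝓡 n) ∞ M] (i : ℕ) (hi : i ≤ n) :
    (∀ ξ : H1 n M, ξ ≠ 0 → IsLeast (morseNumbers i ξ) (mrankClass i ξ)) ∧
    UpperSemicontinuous (mrank i : S n M → ℕ) ∧
    IsOpen (minimalPoints i : Set (S n M)) ∧
    (minimalPoints i : Set (S n M)) ⊆ closure (minimalPoints i ∩ rationalPoints) := by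
  have := finite_H1 n M
  exact ⟨fun ξ _ ↦ isLeast_mrankClass i ξ, upperSemicontinuous_mrank i, isOpen_minimalPoints i,
    minimalPoints_subset_closure i⟩
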